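/- Let $\lambda$ denote Lebesgue measure in the plane $\mathbb{R}^2$, let $o$ be the origin, and let $\mathcal{K}^2_o$ be the family of plane convex bodies (compact convex sets with nonempty interior) that are symmetric with respect to $o$. For $B\in\mathcal{K}^2_o$, Gromov's mass$^*$ in the normed plane with unit ball $B$ is the multiple of Lebesgue measure $$\mathrm{vol}^{m*}_B(S)=\frac{4}{\lambda(C(B))}\,\lambda(S),$$ where $C(B)$ is a minimum area parallelogram circumscribed about (containing) $B$; thus $\mathrm{vol}^{m*}_B(C(B))=4$. For $n\ge 3$ let $$\mu^{m*}_n(B)=\max\{\mathrm{vol}^{m*}_B(Q): Q\subseteq B \text{ is a convex polygon with at most } n \text{ vertices}\},$$ $$m^{m*}(n,2)=\inf\{\mu^{m*}_n(B):B\in\mathcal{K}^2_o\},\qquad M^{m*}(n,2)=\sup\{\mu^{m*}_n(B):B\in\mathcal{K}^2_o\}.$$ A Radon curve is the boundary of some $K\in\mathcal{K}^2_o$ that has a nondegenerate linear image $K'$ for which the polar $K'^\circ=\{y:\langle x,y\rangle\le 1\text{ for all }x\in K'\}$ is the rotated copy of $K'$ by $\pi/2$ around $o$. Theorem 5.1.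 The following hold. (1) $M^{m*}(3,2)=2$, and $\mu^{m*}_3(B)=M^{m*}(3,2)$ for every parallelogram $B\in\mathcal{K}^2_o$. (2) For every $n\ge 4$, $M^{m*}(n,2)=4$, and $\mu^{m*}_n(B)=M^{m*}(n,2)$ for every parallelogram $B\in\mathcal{K}^2_o$. (3) $m^{m*}(4,2)=2$, and $\mu^{m*}_4(B)=m^{m*}(4,2)$ for every $B\in\mathcal{K}^2_o$ whose boundary is a Radon curve. (4) For every $n\ge 3$ there is some $B\in\mathcal{K}^2_o$ such that $\mu^{m*}_n(B)=m^{m*}(n,2)$ and the boundary of $B$ is a Radon curve. -/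

import Mathlib

open MeasureTheory
open scoped ENNReal Pointwise

noncomputable section

/-- Membership in the family of convex bodies (compact, convex, with interior points) in
`d`-dimensional Euclidean space that are symmetric with respect to the origin. -/
structure IsSymmConvexBody {d : ℕ} (B : Set (EuclideanSpace ℝ (Fin d))) : Prop where
  convex : Convex ℝ B
  isCompact : IsCompact B
  interior_nonempty : (interior B).Nonempty
  neg_mem : ∀ x ∈ B, -x ∈ B

/-- A nondegenerate `d`-dimensional parallelotope (a parallelogram if `d = 2`): a translate of
the set of all `∑ i, t i • v i` with `t i ∈ [0, 1]`, for linearly independent edge vectors `v`. -/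
def IsParallelotope {d : ℕ} (P : Set (EuclideanSpace ℝ (Fin d))) : Prop :=
  ∃ (a : EuclideanSpace ℝ (Fin d)) (v : Fin d → EuclideanSpace ℝ (Fin d)),
    LinearIndependent ℝ v ∧ P = a +ᵥ parallelepiped v

/-- The volume of a smallest parallelotope circumscribed about (that is, containing) `B`. -/
def minParallelotopeVolume {d : ℕ} (B : Set (EuclideanSpace ℝ (Fin d))) : ℝ≥0∞ :=
  ⨅ (P : Set (EuclideanSpace ℝ (Fin d))) (_ : IsParallelotope P) (_ : B ⊆ P), volume P

/-- Gromov's mass* of `S` in the normed space with unit ball `B`: the multiple of the Lebesgue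
measure for which a smallest parallelotope circumscribed about `B` has volume `2 ^ d`. -/
def gromovMassStar {d : ℕ} (B S : Set (EuclideanSpace ℝ (Fin d))) : ℝ≥0∞ :=
  2 ^ d / minParallelotopeVolume B * volume S

/-- A convex polytope with at most `n` vertices: the convex hull of at most `n` points. -/
def IsPolytopeWithAtMost {d : ℕ} (n : ℕ) (Q : Set (EuclideanSpace ℝ (Fin d))) : Prop :=
  ∃ s : Finset (EuclideanSpace ℝ (Fin d)), s.card ≤ n ∧
    Q = convexHull ℝ (s : Set (EuclideanSpace ℝ (Fin d)))

/-- The largest Gromov mass*, with respect to the unit ball `B`, of a convex polytope with at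
most `n` vertices that is contained in `B`. -/
def muMassStar {d : ℕ} (n : ℕ) (B : Set (EuclideanSpace ℝ (Fin d))) : ℝ≥0∞ :=
  ⨆ (Q : Set (EuclideanSpace ℝ (Fin d))) (_ : IsPolytopeWithAtMost n Q) (_ : Q ⊆ B),
    gromovMassStar B Q

/-- The infimum of `muMassStar n B` over all origin-symmetric convex bodies `B`. -/
def infMassStar (n d : ℕ) : ℝ≥0∞ :=
  ⨅ (B : Set (EuclideanSpace ℝ (Fin d))) (_ : IsSymmConvexBody B), muMassStar n B

/-- The supremum of `muMassStar n B` over all origin-symmetric convex bodies `B`. -/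
def supMassStar (n d : ℕ) : ℝ≥0∞ :=
  ⨆ (B : Set (EuclideanSpace ℝ (Fin d))) (_ : IsSymmConvexBody B), muMassStar n B

/-- The polar of a set `S`. -/
def polarSet {d : ℕ} (S : Set (EuclideanSpace ℝ (Fin d))) : Set (EuclideanSpace ℝ (Fin d)) :=
  {y | ∀ x ∈ S, inner ℝ x y ≤ 1}

/-- The rotation of the plane by `π / 2` around the origin. -/
def quarterTurn (x : EuclideanSpace ℝ (Fin 2)) : EuclideanSpace ℝ (Fin 2) :=
  !₂[-x 1, x 0]

/-- A Radon curve: the boundary of an origin-symmetric convex disk `K` that has a (nondegenerate)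
linear image whose polar is the rotated copy of this image by `π / 2` around the origin. -/
def IsRadonCurve (γ : Set (EuclideanSpace ℝ (Fin 2))) : Prop :=
  ∃ K : Set (EuclideanSpace ℝ (Fin 2)), IsSymmConvexBody K ∧ γ = frontier K ∧
    ∃ L : EuclideanSpace ℝ (Fin 2) ≃ₗ[ℝ] EuclideanSpace ℝ (Fin 2),
      polarSet (L '' K) = quarterTurn '' (L '' K)

end

/-! Everything is expressed through the determinant of two vectors. Write `m(B)` for the least area
of a parallelogram containing `B`. Parts (1) and (2) are squeezes: a polygon in `B` lies in every
parallelogram around `B`, a triangle covers at most half of a parallelogram, and parallelograms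
attain both bounds. For the lower bound in (3), take `p`, `q` in `B` with maximal determinant `D`.
The parallelogram with vertices `±p`, `±q` has area `2D`, and maximality puts `B` inside the strips
`|det(x,p)| ≤ D`, `|det(x,q)| ≤ D`, which meet in a parallelogram of area `4D`; hence the value is
at least `4 · 2D / 4D = 2` (`two_le_muMassStar_four`). A symmetric body has a Radon boundary exactly
if, for some `δ > 0`, it equals its own polar with respect to `det / δ`
(`isRadonCurve_frontier_iff`). For such a body a quadrilateral has area at most `2δ`, as half of
each diagonal vector lies in the body, and self-polarity gives `m ≥ 4δ`; so the value is exactly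
`2`. For (4), any `B` contains a self-polar body `K` with `m(B) ≤ m(K)`
(`exists_isDetSelfPolar_subset`). Passing from `B` to `K` loses polygons and does not increase the
normalizing factor, so a minimizer can be replaced by a Radon one. A minimizer exists by linear
invariance, Blaschke selection and lower semicontinuity (`exists_muMassStar_minimal`). The infimum
in (3) is then read off a Radon minimizer. -/

noncomputable section

/-! ### Determinants and elementary areas. -/

/-- The Euclidean plane. -/
abbrev Plane := EuclideanSpace ℝ (Fin 2)

/-- The determinant of two vectors of the plane. -/
def det2 (x y : Plane) : ℝ := x 0 * y 1 - x 1 * y 0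

/-- The linear map that takes the standard basis vectors to `v` and `w`. -/
def pairMap (v w : Plane) : Plane →ₗ[ℝ] Plane where
  toFun x := x 0 • v + x 1 • w
  map_add' x y := by simp only [PiLp.add_apply]; module
  map_smul' c x := by simp only [PiLp.smul_apply, smul_eq_mul, RingHom.id_apply]; module

theorem pairMap_apply (v w x : Plane) : pairMap v w x = x 0 • v + x 1 • w := rfl

theorem det_pairMap (v w : Plane) : LinearMap.det (pairMap v w) = det2 v w := by
  rw [← LinearMap.det_toMatrix (EuclideanSpace.basisFun (Fin 2) ℝ).toBasis, Matrix.det_fin_two]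
  simp [LinearMap.toMatrix_apply, pairMap_apply, det2]
  ring

theorem det2_smul_left (c : ℝ) (x y : Plane) : det2 (c • x) y = c * det2 x y := by
  simp [det2]; ring

theorem det2_smul_right (c : ℝ) (x y : Plane) : det2 x (c • y) = c * det2 x y := by
  simp [det2]; ring

theorem det2_add_left (x x' y : Plane) : det2 (x + x') y = det2 x y + det2 x' y := by
  simp [det2]; ring

theorem det2_add_right (x y y' : Plane) : det2 x (y + y') = det2 x y + det2 x y' := by
  simp [det2]; ring

theorem det2_sub_right (x y y' : Plane) : det2 x (y - y') = det2 x y - det2 x y' := by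
  simp [det2]; ring

theorem det2_neg_left (x y : Plane) : det2 (-x) y = -det2 x y := by
  simp [det2]; ring

theorem det2_neg_right (x y : Plane) : det2 x (-y) = -det2 x y := by
  simp [det2]; ring

theorem det2_self (x : Plane) : det2 x x = 0 := by
  simp [det2]; ring

theorem det2_swap (x y : Plane) : det2 y x = -det2 x y := by
  simp [det2]; ring

theorem continuous_det2 : Continuous fun p : Plane × Plane => det2 p.1 p.2 := by
  unfold det2; fun_prop

/-- Cramer's rule in the plane. -/
theorem det2_smul_eq (v w x : Plane) : det2 v w • x = det2 x w • v + det2 v x • w := by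
  ext i
  fin_cases i <;> simp [det2] <;> ring

theorem linearIndependent_iff_det2_ne_zero (v : Fin 2 → Plane) :
    LinearIndependent ℝ v ↔ det2 (v 0) (v 1) ≠ 0 := by
  have hv : v = ![v 0, v 1] := by ext i; fin_cases i <;> rfl
  rw [hv, LinearIndependent.pair_iff]
  simp only [Matrix.cons_val_zero, Matrix.cons_val_one]
  constructor
  · intro h h0
    have hx : ∀ x, det2 x (v 1) = 0 := fun x =>
      (h (det2 x (v 1)) (det2 (v 0) x) (by rw [← det2_smul_eq, h0, zero_smul])).1
    have h1 := hx !₂[1, 0]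
    have h2 := hx !₂[0, 1]
    have hw : v 1 = 0 := by
      ext i; fin_cases i
      · simpa [det2] using h2
      · simpa [det2] using h1
    exact one_ne_zero (h 0 1 (by simp [hw])).2
  · intro h s t hst
    have h1 : s * det2 (v 0) (v 1) = 0 := by
      rw [← det2_smul_left, ← add_zero (det2 _ _), ← mul_zero t, ← det2_self (v 1),
        ← det2_smul_left, ← det2_add_left, hst]
      simp [det2]; ring
    have h2 : t * det2 (v 0) (v 1) = 0 := by
      rw [← det2_smul_right, ← zero_add (det2 _ _), ← mul_zero s, ← det2_self (v 0),
        ← det2_smul_right, ← det2_add_right, hst]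
      simp [det2]; ring
    exact ⟨(mul_eq_zero.1 h1).resolve_right h, (mul_eq_zero.1 h2).resolve_right h⟩

theorem volume_pairMap_image (v w : Plane) (S : Set Plane) :
    volume (pairMap v w '' S) = ENNReal.ofReal |det2 v w| * volume S := by
  rw [Measure.addHaar_image_linearMap, det_pairMap]

theorem volume_parallelepiped_eq (v : Fin 2 → Plane) :
    volume (parallelepiped v) = ENNReal.ofReal |det2 (v 0) (v 1)| := by
  rw [← (EuclideanSpace.basisFun (Fin 2) ℝ).addHaar_eq_volume, Measure.addHaar_parallelepiped,
    Module.Basis.det_apply, Matrix.det_fin_two]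
  congr 2
  simp [Module.Basis.toMatrix_apply, det2]
  ring

theorem volume_vadd_set (a : Plane) (S : Set Plane) : volume (a +ᵥ S) = volume S :=
  measure_vadd volume a S

/-- The triangle with the vertices `0`, `e₁`, `e₂`. -/
def cornerTriangle : Set Plane := {x | 0 ≤ x 0 ∧ 0 ≤ x 1 ∧ x 0 + x 1 ≤ 1}

theorem mem_parallelepiped_iff_exists (v : Fin 2 → Plane) (x : Plane) :
    x ∈ parallelepiped v ↔
      ∃ s t : ℝ, 0 ≤ s ∧ s ≤ 1 ∧ 0 ≤ t ∧ t ≤ 1 ∧ x = s • v 0 + t • v 1 := by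
  rw [mem_parallelepiped_iff]
  constructor
  · rintro ⟨t, ⟨h0, h1⟩, rfl⟩
    exact ⟨t 0, t 1, h0 0, h1 0, h0 1, h1 1, by simp⟩
  · rintro ⟨s, t, hs, hs', ht, ht', rfl⟩
    refine ⟨![s, t], ⟨fun i => ?_, fun i => ?_⟩, by simp⟩ <;> fin_cases i <;> simpa

theorem measurableSet_cornerTriangle : MeasurableSet cornerTriangle := by
  refine (IsClosed.inter (isClosed_le (f := fun _ : Plane => (0 : ℝ)) (g := fun x => x 0)
    (by fun_prop) (by fun_prop)) (IsClosed.inter (isClosed_le (f := fun _ : Plane => (0 : ℝ))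
    (g := fun x => x 1) (by fun_prop) (by fun_prop)) (isClosed_le
    (f := fun x : Plane => x 0 + x 1) (g := fun _ => (1 : ℝ))
    (by fun_prop) (by fun_prop)))).measurableSet

/-- The triangle and its point reflection in the centre of the unit square cover the square and
overlap in a null segment. -/
theorem volume_cornerTriangle : volume cornerTriangle = 2⁻¹ := by
  set T' : Set Plane := (!₂[1, 1] : Plane) +ᵥ (Neg.neg '' cornerTriangle) with hT'
  have mem' : ∀ x : Plane, x ∈ T' ↔ x 0 ≤ 1 ∧ x 1 ≤ 1 ∧ 1 ≤ x 0 + x 1 := by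
    intro x
    rw [hT', Set.image_neg_eq_neg, Set.mem_vadd_set_iff_neg_vadd_mem, Set.mem_neg]
    simp only [cornerTriangle, Set.mem_ofPred_eq, vadd_eq_add, neg_add, neg_neg]
    simp
    intro _ _
    constructor <;> intro h <;> linarith
  have hvol : volume T' = volume cornerTriangle := by
    rw [hT', volume_vadd_set, Set.image_neg_eq_neg, Measure.measure_neg]
  have hU : cornerTriangle ∪ T' = parallelepiped ![!₂[1, 0], !₂[0, 1]] := by
    ext x
    rw [mem_parallelepiped_iff_exists, Set.mem_union, mem']
    simp only [cornerTriangle, Set.mem_ofPred_eq]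
    constructor
    · intro h
      refine ⟨x 0, x 1, ?_, ?_, ?_, ?_, ?_⟩
      · rcases h with h | h <;> linarith
      · rcases h with h | h <;> linarith
      · rcases h with h | h <;> linarith
      · rcases h with h | h <;> linarith
      · ext i; fin_cases i <;> simp
    · rintro ⟨s, t, h1, h2, h3, h4, rfl⟩
      simp
      rcases le_total (s + t) 1 with h | h
      · exact Or.inl ⟨h1, h3, h⟩
      · exact Or.inr ⟨h2, h4, h⟩
  have hI : volume (cornerTriangle ∩ T') = 0 := by
    have hsub : cornerTriangle ∩ T' ⊆
        (!₂[1, 0] : Plane) +ᵥ (pairMap 0 (!₂[-1, 1]) '' Set.univ) := by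
      rintro x ⟨hx, hx'⟩
      rw [mem'] at hx'
      refine ⟨pairMap 0 (!₂[-1, 1]) x, ⟨x, trivial, rfl⟩, ?_⟩
      have : x 0 + x 1 = 1 := le_antisymm hx.2.2 hx'.2.2
      ext i; fin_cases i <;> simp [pairMap_apply]; linarith
    refine measure_mono_null hsub ?_
    rw [volume_vadd_set, volume_pairMap_image]
    simp [det2]
  have h := measure_union_add_inter' (μ := volume) measurableSet_cornerTriangle T'
  rw [hU, hI, hvol, volume_parallelepiped_eq] at h
  simp [det2] at h
  rw [← two_mul] at h
  exact ENNReal.eq_inv_of_mul_eq_one_left (by rw [mul_comm]; exact h.symm)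

theorem convex_cornerTriangle : Convex ℝ cornerTriangle := by
  rintro x ⟨hx0, hx1, hx⟩ y ⟨hy0, hy1, hy⟩ a b ha hb hab
  refine ⟨?_, ?_, ?_⟩ <;> simp
  · positivity
  · positivity
  · nlinarith

theorem convexHull_triangle_eq (a b c : Plane) :
    convexHull ℝ {a, b, c} = a +ᵥ (pairMap (b - a) (c - a) '' cornerTriangle) := by
  apply Set.Subset.antisymm
  · refine convexHull_min ?_ ((convex_cornerTriangle.linear_image _).vadd a)
    rintro x (rfl | rfl | rfl)
    · exact ⟨0, ⟨0, by simp [cornerTriangle], by simp⟩, by simp⟩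
    · exact ⟨x - a, ⟨!₂[1, 0], by simp [cornerTriangle], by simp [pairMap_apply]⟩, by simp⟩
    · exact ⟨x - a, ⟨!₂[0, 1], by simp [cornerTriangle], by simp [pairMap_apply]⟩, by simp⟩
  · rintro _ ⟨_, ⟨x, ⟨h0, h1, h2⟩, rfl⟩, rfl⟩
    have ha : a ∈ convexHull ℝ {a, b, c} := subset_convexHull ℝ _ (by simp)
    have hb : b ∈ convexHull ℝ {a, b, c} := subset_convexHull ℝ _ (by simp)
    have hc : c ∈ convexHull ℝ {a, b, c} := subset_convexHull ℝ _ (by simp)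
    have := (convex_convexHull ℝ {a, b, c}).sum_mem (t := Finset.univ)
      (w := ![1 - x 0 - x 1, x 0, x 1]) (z := ![a, b, c])
      (by intro i _; fin_cases i <;> simp <;> linarith)
      (by simp [Fin.sum_univ_three]; ring) (by intro i _; fin_cases i <;> simpa)
    convert this using 1
    simp [Fin.sum_univ_three, pairMap_apply]
    module

theorem volume_triangle (a b c : Plane) :
    volume (convexHull ℝ {a, b, c}) = ENNReal.ofReal (|det2 (b - a) (c - a)| / 2) := by
  rw [convexHull_triangle_eq, volume_vadd_set, volume_pairMap_image, volume_cornerTriangle,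
    div_eq_mul_inv, ENNReal.ofReal_mul (abs_nonneg _), ENNReal.ofReal_inv_of_pos two_pos]
  simp

/-- A parallelogram is the convex hull of its vertices. -/
theorem vadd_parallelepiped_eq_convexHull (a : Plane) (v : Fin 2 → Plane) :
    a +ᵥ parallelepiped v = convexHull ℝ {a, a + v 0, a + v 1, a + v 0 + v 1} := by
  apply Set.Subset.antisymm
  · rintro _ ⟨x, hx, rfl⟩
    obtain ⟨s, t, hs, hs', ht, ht', rfl⟩ := (mem_parallelepiped_iff_exists v x).1 hx
    have := (convex_convexHull ℝ {a, a + v 0, a + v 1, a + v 0 + v 1}).sum_mem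
      (t := Finset.univ)
      (w := ![(1 - s) * (1 - t), s * (1 - t), (1 - s) * t, s * t])
      (z := ![a, a + v 0, a + v 1, a + v 0 + v 1])
      (by intro i _; fin_cases i <;> simp <;> apply mul_nonneg <;> linarith)
      (by simp [Fin.sum_univ_four]; ring)
      (by intro i _; apply subset_convexHull ℝ _; fin_cases i <;> simp)
    convert this using 1
    simp [Fin.sum_univ_four]
    module
  · refine convexHull_min ?_ ((convex_parallelepiped v).vadd a)
    rintro x (rfl | rfl | rfl | rfl)
    · exact ⟨0, (mem_parallelepiped_iff_exists v _).2 ⟨0, 0, by simp⟩, by simp⟩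
    · exact ⟨v 0, (mem_parallelepiped_iff_exists v _).2 ⟨1, 0, by simp⟩, by simp⟩
    · exact ⟨v 1, (mem_parallelepiped_iff_exists v _).2 ⟨0, 1, by simp⟩, by simp⟩
    · exact ⟨v 0 + v 1, (mem_parallelepiped_iff_exists v _).2 ⟨1, 1, by simp⟩, by
        simp [add_assoc]⟩

/-! ### Area bounds for triangles and quadrilaterals. -/

/-- The determinant is a combination of the cyclic differences of the `yᵢ` with weights `xᵢ` in `[0,
1]`. These differences sum to zero, and their positive parts sum to `max y - min y ≤ 1`. -/
theorem abs_det_unit_triangle_le {x₁ x₂ x₃ y₁ y₂ y₃ : ℝ} (hx₁ : x₁ ∈ Set.Icc (0 : ℝ) 1)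
    (hx₂ : x₂ ∈ Set.Icc (0 : ℝ) 1) (hx₃ : x₃ ∈ Set.Icc (0 : ℝ) 1) (hy₁ : y₁ ∈ Set.Icc (0 : ℝ) 1)
    (hy₂ : y₂ ∈ Set.Icc (0 : ℝ) 1) (hy₃ : y₃ ∈ Set.Icc (0 : ℝ) 1) :
    |(x₂ - x₁) * (y₃ - y₁) - (y₂ - y₁) * (x₃ - x₁)| ≤ 1 := by
  obtain ⟨hx₁, hx₁'⟩ := hx₁
  obtain ⟨hx₂, hx₂'⟩ := hx₂
  obtain ⟨hx₃, hx₃'⟩ := hx₃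
  obtain ⟨hy₁, hy₁'⟩ := hy₁
  obtain ⟨hy₂, hy₂'⟩ := hy₂
  obtain ⟨hy₃, hy₃'⟩ := hy₃
  have key : ∀ {x d : ℝ}, 0 ≤ x → x ≤ 1 → min d 0 ≤ x * d ∧ x * d ≤ max d 0 := by
    intro x d h0 h1
    rcases le_total 0 d with h | h
    · rw [min_eq_right h, max_eq_left h]
      exact ⟨by positivity, mul_le_of_le_one_left h h1⟩
    · rw [min_eq_left h, max_eq_right h]
      exact ⟨by nlinarith, mul_nonpos_of_nonneg_of_nonpos h0 h⟩
  have e : (x₂ - x₁) * (y₃ - y₁) - (y₂ - y₁) * (x₃ - x₁)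
      = x₁ * (y₂ - y₃) + x₂ * (y₃ - y₁) + x₃ * (y₁ - y₂) := by ring
  rw [e, abs_le]
  have k₁ := key (d := y₂ - y₃) hx₁ hx₁'
  have k₂ := key (d := y₃ - y₁) hx₂ hx₂'
  have k₃ := key (d := y₁ - y₂) hx₃ hx₃'
  rcases le_total (y₂ - y₃) 0 with a | a <;> rcases le_total (y₃ - y₁) 0 with b | b <;>
    rcases le_total (y₁ - y₂) 0 with c | c <;> simp only [a, b, c, min_eq_left, min_eq_right,
      max_eq_left, max_eq_right] at k₁ k₂ k₃ <;> constructor <;> linarith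

/-- Labelling with repetitions makes degenerate polygons instances of the generic case. -/
theorem exists_range_eq_of_card_le {α : Type*} {n : ℕ} {s : Finset α} (hs : s.Nonempty)
    (h : s.card ≤ n) : ∃ f : Fin n → α, Set.range f = s := by
  obtain ⟨e⟩ := Function.Embedding.nonempty_of_card_le (α := s) (β := Fin n) (by simpa using h)
  have : Nonempty s := hs.to_subtype
  refine ⟨fun i => (Function.invFun e i : s), ?_⟩
  ext x
  constructor
  · rintro ⟨i, rfl⟩; exact (Function.invFun e i).2
  · intro hx
    obtain ⟨i, hi⟩ := Function.invFun_surjective e.injective ⟨x, hx⟩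
    exact ⟨i, by simp [hi]⟩

theorem range_fin_three {α : Type*} (f : Fin 3 → α) : Set.range f = {f 0, f 1, f 2} := by
  ext x; simp [Fin.exists_fin_succ, eq_comm]

/-- A triangle contained in a parallelogram has at most half its area. -/
theorem volume_triangle_le_of_subset_parallelogram {Q : Set Plane} (hQ : IsPolytopeWithAtMost 3 Q)
    (a : Plane) (v : Fin 2 → Plane) (h : Q ⊆ a +ᵥ parallelepiped v) :
    volume Q ≤ ENNReal.ofReal (|det2 (v 0) (v 1)| / 2) := by
  obtain ⟨s, hs, rfl⟩ := hQ
  rcases s.eq_empty_or_nonempty with rfl | hne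
  · simp
  obtain ⟨f, hf⟩ := exists_range_eq_of_card_le hne hs
  have hm : ∀ i, ∃ s t : ℝ, s ∈ Set.Icc (0 : ℝ) 1 ∧ t ∈ Set.Icc (0 : ℝ) 1 ∧
      f i = a + (s • v 0 + t • v 1) := by
    intro i
    obtain ⟨y, hy, hyi⟩ := h (subset_convexHull ℝ _ (hf ▸ Set.mem_range_self i))
    obtain ⟨s, t, h1, h2, h3, h4, rfl⟩ := (mem_parallelepiped_iff_exists v y).1 hy
    exact ⟨s, t, ⟨h1, h2⟩, ⟨h3, h4⟩, hyi.symm⟩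
  choose s t hs ht hst using hm
  rw [← hf, range_fin_three, volume_triangle]
  apply ENNReal.ofReal_le_ofReal
  have e : det2 (f 1 - f 0) (f 2 - f 0) =
      ((s 1 - s 0) * (t 2 - t 0) - (t 1 - t 0) * (s 2 - s 0)) * det2 (v 0) (v 1) := by
    simp only [hst, det2, PiLp.add_apply, PiLp.sub_apply, PiLp.smul_apply, smul_eq_mul]; ring
  rw [e, abs_mul]
  have := abs_det_unit_triangle_le (hs 0) (hs 1) (hs 2) (ht 0) (ht 1) (ht 2)
  have := mul_le_of_le_one_left (abs_nonneg (det2 (v 0) (v 1))) this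
  linarith

theorem segment_subset_union_segment {E : Type*} [AddCommGroup E] [Module ℝ E] {b d x : E}
    (hx : x ∈ segment ℝ b d) : segment ℝ b d ⊆ segment ℝ b x ∪ segment ℝ x d := by
  rw [← insert_endpoints_openSegment]
  have h := openSegment_subset_union b d (z := x) (𝕜 := ℝ)
    (segment_eq_image_lineMap ℝ b d ▸ hx |> fun ⟨t, _, ht⟩ => ⟨t, ht⟩)
  rintro z (rfl | rfl | hz)
  · exact Or.inl (left_mem_segment ℝ _ _)
  · exact Or.inr (right_mem_segment ℝ _ _)
  · rcases h hz with rfl | hz | hz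
    · exact Or.inl (right_mem_segment ℝ _ _)
    · exact Or.inl (openSegment_subset_segment ℝ _ _ hz)
    · exact Or.inr (openSegment_subset_segment ℝ _ _ hz)

/-- The area of a quadrilateral in terms of its diagonals. -/
theorem volume_quadrilateral_le {a b c d x : Plane} (hac : x ∈ segment ℝ a c)
    (hbd : x ∈ segment ℝ b d) :
    volume (convexHull ℝ {a, c, b, d}) ≤ ENNReal.ofReal (|det2 (c - a) (b - d)| / 2) := by
  -- The diagonal `ac` cuts the quadrilateral in two, because the crossing point `x` splits `bd`.
  have hsub : convexHull ℝ {a, c, b, d} ⊆ convexHull ℝ {a, c, b} ∪ convexHull ℝ {a, c, d} := by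
    intro p hp
    rw [← convexJoin_segments, mem_convexJoin] at hp
    obtain ⟨y, hy, z, hz, hp⟩ := hp
    have aux : ∀ e : Plane, z ∈ segment ℝ x e → p ∈ convexHull ℝ {a, c, e} := by
      intro e hze
      have hC := convex_convexHull ℝ ({a, c, e} : Set Plane)
      have ha : a ∈ convexHull ℝ {a, c, e} := subset_convexHull ℝ _ (by simp)
      have hc : c ∈ convexHull ℝ {a, c, e} := subset_convexHull ℝ _ (by simp)
      have he : e ∈ convexHull ℝ {a, c, e} := subset_convexHull ℝ _ (by simp)
      have hac' := hC.segment_subset ha hc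
      exact hC.segment_subset (hac' hy) (hC.segment_subset (hac' hac) he hze) hp
    rcases segment_subset_union_segment hbd hz with h | h
    · exact Or.inl (aux b (segment_symm ℝ x b ▸ h))
    · exact Or.inr (aux d h)
  refine (measure_mono hsub).trans ((measure_union_le _ _).trans ?_)
  rw [volume_triangle, volume_triangle, ← ENNReal.ofReal_add (by positivity) (by positivity)]
  apply ENNReal.ofReal_le_ofReal
  obtain ⟨α, α', -, -, hα, rfl⟩ := hac
  obtain ⟨β, β', hβ0, hβ0', hβ, hx⟩ := hbd
  have e1 : det2 (c - a) (b - d) = det2 (c - a) (b - a) - det2 (c - a) (d - a) := by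
    rw [← det2_sub_right]; congr 1; abel
  -- As `x` lies on the line `ac`, the weighted signed distances of `b` and `d` from this line
  -- cancel. So the two triangles have opposite orientation or one is degenerate, and their areas
  -- add up to the bound.
  have e2 : β * det2 (c - a) (b - a) + β' * det2 (c - a) (d - a) = 0 := by
    rw [← det2_smul_right, ← det2_smul_right, ← det2_add_right]
    have : β • (b - a) + β' • (d - a) = α' • (c - a) := by
      have h1 : β • (b - a) + β' • (d - a) = (β • b + β' • d) - (β + β') • a := by module
      rw [h1, hx, hβ, ← hα]; module
    rw [this, det2_smul_right, det2_self, mul_zero]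
  rw [e1]
  generalize det2 (c - a) (b - a) = P at *
  generalize det2 (c - a) (d - a) = R at *
  obtain rfl : β' = 1 - β := by linarith
  rcases le_total 0 P with hP | hP <;> rcases le_total 0 R with hR | hR
  · have h1 : β * P = 0 := by nlinarith [mul_nonneg hβ0 hP, mul_nonneg hβ0' hR]
    rcases mul_eq_zero.1 h1 with rfl | rfl
    · obtain rfl : R = 0 := by linarith
      simp
    · simp [abs_of_nonneg hR]
  · rw [abs_of_nonneg hP, abs_of_nonpos hR, abs_of_nonneg (by linarith)]; linarith
  · rw [abs_of_nonneg hR, abs_of_nonpos hP, abs_of_nonpos (by linarith)]; linarith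
  · have h1 : β * P = 0 := by
      nlinarith [mul_nonneg hβ0 (neg_nonneg.2 hP), mul_nonneg hβ0' (neg_nonneg.2 hR)]
    rcases mul_eq_zero.1 h1 with rfl | rfl
    · obtain rfl : R = 0 := by linarith
      simp
    · simp [abs_of_nonpos hR]

/-- Four points of the plane form a triangle that contains one of them, or two crossing
segments. -/
theorem exists_triangle_or_crossing (f : Fin 4 → Plane) :
    (∃ i j k l, Set.range f = {f i, f j, f k, f l} ∧ f i ∈ convexHull ℝ {f j, f k, f l}) ∨
    ∃ i j k l x, Set.range f = {f i, f j, f k, f l} ∧ x ∈ segment ℝ (f i) (f j) ∧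
      x ∈ segment ℝ (f k) (f l) := by
  classical
  have hdep : ¬ AffineIndependent ℝ f := by
    rw [← finrank_vectorSpan_le_iff_not_affineIndependent ℝ f (n := 2) (by simp)]
    exact (Submodule.finrank_le _).trans (by simp)
  -- The smaller class of the Radon partition has one point (a point inside a triangle) or two
  -- (crossing segments); it cannot be empty.
  obtain ⟨I, hI⟩ := Convex.radon_partition hdep
  have key : ∀ J : Finset (Fin 4), J.card ≤ 2 →
      (convexHull ℝ (f '' J) ∩ convexHull ℝ (f '' ((Jᶜ : Finset (Fin 4)) : Set (Fin 4)))).Nonempty →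
      (∃ i j k l, Set.range f = {f i, f j, f k, f l} ∧ f i ∈ convexHull ℝ {f j, f k, f l}) ∨
      ∃ i j k l x, Set.range f = {f i, f j, f k, f l} ∧ x ∈ segment ℝ (f i) (f j) ∧
        x ∈ segment ℝ (f k) (f l) := by
    intro J hJ hne
    have hr : Set.range f = f '' J ∪ f '' ((Jᶜ : Finset (Fin 4)) : Set (Fin 4)) := by
      rw [← Set.image_union, ← Finset.coe_union, Finset.union_compl, Finset.coe_univ,
        Set.image_univ]
    have hcard : Jᶜ.card = 4 - J.card := by rw [Finset.card_compl]; simp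
    interval_cases h : J.card
    · rw [Finset.card_eq_zero] at h
      subst h
      simp at hne
    · obtain ⟨i, rfl⟩ := Finset.card_eq_one.1 h
      obtain ⟨j, k, l, -, -, -, e⟩ := Finset.card_eq_three.1 hcard
      rw [e] at hr hne
      obtain ⟨x, hx, hx'⟩ := hne
      simp only [Finset.coe_singleton, Set.image_singleton, convexHull_singleton,
        Set.mem_singleton_iff, Finset.coe_insert, Set.image_insert_eq] at hx hx' hr
      subst hx
      exact Or.inl ⟨i, j, k, l, hr, hx'⟩
    · obtain ⟨i, j, -, rfl⟩ := Finset.card_eq_two.1 h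
      obtain ⟨k, l, -, e⟩ := Finset.card_eq_two.1 hcard
      rw [e] at hr hne
      obtain ⟨x, hx, hx'⟩ := hne
      simp only [Finset.coe_singleton, Set.image_singleton, convexHull_pair,
        Finset.coe_insert, Set.image_insert_eq] at hx hx' hr
      refine Or.inr ⟨i, j, k, l, x, ?_, hx, hx'⟩
      rw [hr, Set.insert_union, Set.singleton_union]
  rcases le_total I.toFinset.card 2 with h | h
  · exact key _ h (by simpa using hI)
  · refine key I.toFinsetᶜ ?_ ?_
    · rw [Finset.card_compl, Fintype.card_fin]; omega
    · rw [compl_compl, Set.inter_comm]; simpa using hI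

/-- If the determinants of pairs of points of a symmetric convex set are at most `D`, then the
area of a quadrilateral in it is at most `2 * D`. -/
theorem volume_quadrilateral_le_of_det2_le {B : Set Plane} {D : ℝ} (hB : Convex ℝ B)
    (hneg : ∀ x ∈ B, -x ∈ B) (hD : ∀ x ∈ B, ∀ y ∈ B, |det2 x y| ≤ D) {Q : Set Plane}
    (hQ : IsPolytopeWithAtMost 4 Q) (hQB : Q ⊆ B) : volume Q ≤ ENNReal.ofReal (2 * D) := by
  -- By symmetry and convexity half-differences stay in `B`, so the determinant of two differences
  -- is at most `4D`. This covers both diagonals of a quadrilateral and edges of a triangle.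
  have hdiff : ∀ x ∈ B, ∀ y ∈ B, ∀ z ∈ B, ∀ w ∈ B, |det2 (x - y) (z - w)| / 2 ≤ 2 * D := by
    intro x hx y hy z hz w hw
    have aux : ∀ x ∈ B, ∀ y ∈ B, (2⁻¹ : ℝ) • (x - y) ∈ B := by
      intro x hx y hy
      have := hB hx (hneg y hy) (a := 2⁻¹) (b := 2⁻¹) (by norm_num) (by norm_num) (by norm_num)
      convert this using 1
      module
    have := hD _ (aux x hx y hy) _ (aux z hz w hw)
    rw [det2_smul_left, det2_smul_right, abs_mul, abs_mul, abs_of_pos (by norm_num : (0:ℝ) < 2⁻¹)]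
      at this
    linarith
  obtain ⟨s, hs, rfl⟩ := hQ
  rcases s.eq_empty_or_nonempty with rfl | hne
  · simp
  obtain ⟨f, hf⟩ := exists_range_eq_of_card_le hne hs
  have hm : ∀ i, f i ∈ B := fun i => hQB (subset_convexHull ℝ _ (hf ▸ Set.mem_range_self i))
  rw [← hf]
  rcases exists_triangle_or_crossing f with ⟨i, j, k, l, hr, hi⟩ | ⟨i, j, k, l, x, hr, hx, hx'⟩
  · have hsub : convexHull ℝ (Set.range f) ⊆ convexHull ℝ {f j, f k, f l} := by
      rw [hr]
      refine convexHull_min ?_ (convex_convexHull ℝ _)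
      rintro x (rfl | hx)
      · exact hi
      · exact subset_convexHull ℝ _ hx
    refine (measure_mono hsub).trans ?_
    rw [volume_triangle]
    exact ENNReal.ofReal_le_ofReal (hdiff _ (hm _) _ (hm _) _ (hm _) _ (hm _))
  · rw [hr]
    exact (volume_quadrilateral_le hx hx').trans
      (ENNReal.ofReal_le_ofReal (hdiff _ (hm _) _ (hm _) _ (hm _) _ (hm _)))

/-! ### Monotonicity, linear invariance and stability of the functionals. -/

theorem minParallelotopeVolume_le {B P : Set Plane} (hP : IsParallelotope P) (h : B ⊆ P) :
    minParallelotopeVolume B ≤ volume P :=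
  iInf_le_of_le P (iInf_le_of_le hP (iInf_le _ h))

theorem minParallelotopeVolume_mono {B C : Set Plane} (h : B ⊆ C) :
    minParallelotopeVolume B ≤ minParallelotopeVolume C :=
  le_iInf fun _ => le_iInf fun hP => le_iInf fun hC => minParallelotopeVolume_le hP (h.trans hC)

theorem volume_le_minParallelotopeVolume (B : Set Plane) :
    volume B ≤ minParallelotopeVolume B :=
  le_iInf fun _ => le_iInf fun _ => le_iInf fun h => measure_mono h

theorem le_muMassStar {n : ℕ} {B Q : Set Plane} (hQ : IsPolytopeWithAtMost n Q) (h : Q ⊆ B) :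
    2 ^ 2 / minParallelotopeVolume B * volume Q ≤ muMassStar n B :=
  le_iSup_of_le (f := fun Q => ⨆ (_ : IsPolytopeWithAtMost n Q) (_ : Q ⊆ B), gromovMassStar B Q) Q
    (le_iSup_of_le hQ (le_iSup_of_le (f := fun _ : Q ⊆ B => gromovMassStar B Q) h le_rfl))

theorem muMassStar_le {n : ℕ} {B : Set Plane} {c : ℝ≥0∞}
    (h : ∀ Q, IsPolytopeWithAtMost n Q → Q ⊆ B →
      2 ^ 2 / minParallelotopeVolume B * volume Q ≤ c) : muMassStar n B ≤ c :=
  iSup_le fun Q => iSup_le fun hQ => iSup_le fun hB => h Q hQ hB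

theorem IsParallelotope.image {P : Set Plane} (hP : IsParallelotope P) (L : Plane ≃ₗ[ℝ] Plane) :
    IsParallelotope (L '' P) := by
  obtain ⟨a, v, hv, rfl⟩ := hP
  refine ⟨L a, L ∘ v, hv.map' (L : Plane →ₗ[ℝ] Plane) L.ker, ?_⟩
  have h := image_parallelepiped (L : Plane →ₗ[ℝ] Plane) v
  simp only [LinearEquiv.coe_coe] at h
  rw [← h]
  ext x
  simp [Set.mem_vadd_set]

theorem IsPolytopeWithAtMost.image {n : ℕ} {Q : Set Plane} (hQ : IsPolytopeWithAtMost n Q)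
    (L : Plane ≃ₗ[ℝ] Plane) : IsPolytopeWithAtMost n (L '' Q) := by
  classical
  obtain ⟨s, hs, rfl⟩ := hQ
  refine ⟨s.image L, Finset.card_image_le.trans hs, ?_⟩
  rw [Finset.coe_image]
  exact (L : Plane →ₗ[ℝ] Plane).image_convexHull _

theorem volume_linearEquiv_image (L : Plane ≃ₗ[ℝ] Plane) (S : Set Plane) :
    volume (L '' S) = ENNReal.ofReal |LinearMap.det (L : Plane →ₗ[ℝ] Plane)| * volume S :=
  Measure.addHaar_image_linearMap volume (L : Plane →ₗ[ℝ] Plane) S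

theorem ofReal_abs_det_ne_zero (L : Plane ≃ₗ[ℝ] Plane) :
    ENNReal.ofReal |LinearMap.det (L : Plane →ₗ[ℝ] Plane)| ≠ 0 := by
  simpa using (LinearEquiv.isUnit_det' L).ne_zero

theorem minParallelotopeVolume_image (L : Plane ≃ₗ[ℝ] Plane) (B : Set Plane) :
    minParallelotopeVolume (L '' B) =
      ENNReal.ofReal |LinearMap.det (L : Plane →ₗ[ℝ] Plane)| * minParallelotopeVolume B := by
  apply le_antisymm
  · unfold minParallelotopeVolume
    rw [ENNReal.mul_iInf_of_ne (ofReal_abs_det_ne_zero L) ENNReal.ofReal_ne_top]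
    refine le_iInf fun P => ?_
    rw [ENNReal.mul_iInf_of_ne (ofReal_abs_det_ne_zero L) ENNReal.ofReal_ne_top]
    refine le_iInf fun hP => ?_
    rw [ENNReal.mul_iInf_of_ne (ofReal_abs_det_ne_zero L) ENNReal.ofReal_ne_top]
    refine le_iInf fun hB => ?_
    rw [← volume_linearEquiv_image]
    exact minParallelotopeVolume_le (hP.image L) (Set.image_mono hB)
  · refine le_iInf fun P => le_iInf fun hP => le_iInf fun hB => ?_
    have hP' : P = L '' (L.symm '' P) := by simp [Set.image_image]
    rw [hP', volume_linearEquiv_image]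
    gcongr
    refine minParallelotopeVolume_le (hP.image L.symm) ?_
    have := Set.image_mono (f := L.symm) hB
    simpa [Set.image_image] using this

theorem muMassStar_image_le (n : ℕ) (L : Plane ≃ₗ[ℝ] Plane) (B : Set Plane) :
    muMassStar n (L '' B) ≤ muMassStar n B := by
  refine muMassStar_le fun Q hQ hB => ?_
  have hQ' : Q = L '' (L.symm '' Q) := by simp [Set.image_image]
  have hB' : L.symm '' Q ⊆ B := by
    have := Set.image_mono (f := L.symm) hB
    simpa [Set.image_image] using this
  refine le_trans (le_of_eq ?_) (le_muMassStar (hQ.image L.symm) hB')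
  conv_lhs => rw [hQ', volume_linearEquiv_image, minParallelotopeVolume_image]
  rw [← mul_assoc, mul_comm (ENNReal.ofReal _) (minParallelotopeVolume B), div_eq_mul_inv,
    ENNReal.mul_inv (Or.inr ENNReal.ofReal_ne_top) (Or.inr (ofReal_abs_det_ne_zero L)),
    div_eq_mul_inv, ← mul_assoc, mul_assoc _ _ (ENNReal.ofReal _),
    ENNReal.inv_mul_cancel (ofReal_abs_det_ne_zero L) ENNReal.ofReal_ne_top, mul_one]

theorem muMassStar_image (n : ℕ) (L : Plane ≃ₗ[ℝ] Plane) (B : Set Plane) :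
    muMassStar n (L '' B) = muMassStar n B := by
  refine le_antisymm (muMassStar_image_le n L B) ?_
  have := muMassStar_image_le n L.symm (L '' B)
  simpa [Set.image_image] using this

/-- Every polygon in `B` competes in `C`, and replacing `C` by `B` increases the normalizing factor
at most `c` times. -/
theorem muMassStar_le_mul {n : ℕ} {B C : Set Plane} {c : ℝ≥0∞} (h0 : c ≠ 0) (ht : c ≠ ∞)
    (hBC : B ⊆ C) (h : minParallelotopeVolume C ≤ c * minParallelotopeVolume B) :
    muMassStar n B ≤ c * muMassStar n C := by
  refine muMassStar_le fun Q hQ hB => ?_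
  refine le_trans ?_ (mul_le_mul_right (le_muMassStar hQ (hB.trans hBC)) c)
  rw [← mul_assoc]
  gcongr
  rw [div_eq_mul_inv, div_eq_mul_inv, mul_left_comm]
  gcongr
  have := ENNReal.inv_le_inv.2 h
  rw [ENNReal.mul_inv (Or.inl h0) (Or.inl ht)] at this
  calc (minParallelotopeVolume B)⁻¹ = c * (c⁻¹ * (minParallelotopeVolume B)⁻¹) := by
        rw [← mul_assoc, ENNReal.mul_inv_cancel h0 ht, one_mul]
    _ ≤ _ := by gcongr

/-- The functional `muMassStar` changes little under small perturbations of the body. -/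
theorem muMassStar_le_of_subset_smul {n : ℕ} {B C : Set Plane} {t : ℝ} (ht : 0 < t)
    (hBC : B ⊆ t • C) (hCB : C ⊆ t • B) :
    muMassStar n B ≤ ENNReal.ofReal t ^ 4 * muMassStar n C := by
  set L : Plane ≃ₗ[ℝ] Plane := LinearEquiv.smulOfNeZero ℝ Plane t ht.ne' with hL
  have himg : ∀ S : Set Plane, t • S = L '' S := fun S => rfl
  have hdet : ENNReal.ofReal |LinearMap.det (L : Plane →ₗ[ℝ] Plane)| = ENNReal.ofReal t ^ 2 := by
    have : (L : Plane →ₗ[ℝ] Plane) = t • LinearMap.id := by ext; rfl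
    rw [this, LinearMap.det_smul, finrank_euclideanSpace_fin, LinearMap.det_id, mul_one,
      abs_of_nonneg (by positivity), ENNReal.ofReal_pow ht.le]
  have hmin : ∀ S : Set Plane,
      minParallelotopeVolume (t • S) = ENNReal.ofReal t ^ 2 * minParallelotopeVolume S := by
    intro S; rw [himg, minParallelotopeVolume_image, hdet]
  rw [← muMassStar_image n L C]
  refine muMassStar_le_mul (by positivity) (ENNReal.pow_ne_top ENNReal.ofReal_ne_top) hBC ?_
  rw [← himg, hmin]
  -- The exponent 4 consists of one area factor `t ^ 2` for enlarging `C` to contain `B` and another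
  -- for enlarging `B` to contain `C`.
  calc ENNReal.ofReal t ^ 2 * minParallelotopeVolume C
      ≤ ENNReal.ofReal t ^ 2 * (ENNReal.ofReal t ^ 2 * minParallelotopeVolume B) := by
        rw [← hmin B]; gcongr; exact minParallelotopeVolume_mono hCB
    _ = _ := by ring

/-- The two strips intersect in the parallelogram centred at the origin with edges `2σp`, `2σq`,
where `σ = c / |det2 p q|` by Cramer's rule; its area is `4σ²|det2 p q|`. -/
theorem minParallelotopeVolume_le_of_det2_le {B : Set Plane} {p q : Plane} {c : ℝ} (hc : 0 < c)
    (hpq : det2 p q ≠ 0) (hp : ∀ x ∈ B, |det2 x p| ≤ c) (hq : ∀ x ∈ B, |det2 x q| ≤ c) :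
    minParallelotopeVolume B ≤ ENNReal.ofReal (4 * c ^ 2 / |det2 p q|) := by
  have hd : 0 < |det2 p q| := abs_pos.2 hpq
  set σ := c / |det2 p q| with hσ
  have hσ0 : 0 < σ := by positivity
  set v : Fin 2 → Plane := ![(2 * σ) • p, (2 * σ) • q] with hv
  have hdv : det2 (v 0) (v 1) = 4 * σ ^ 2 * det2 p q := by
    simp [hv, det2_smul_left, det2_smul_right]; ring
  have hvol : ENNReal.ofReal (4 * c ^ 2 / |det2 p q|)
      = volume ((-(σ • p + σ • q)) +ᵥ parallelepiped v) := by
    rw [volume_vadd_set, volume_parallelepiped_eq, hdv, abs_mul,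
      abs_of_pos (by positivity : 0 < 4 * σ ^ 2), hσ]
    congr 1
    field_simp
  rw [hvol]
  refine minParallelotopeVolume_le ⟨_, v, ?_, rfl⟩ ?_
  · rw [linearIndependent_iff_det2_ne_zero, hdv]
    positivity
  · intro x hx
    have hbound : ∀ y, |y| ≤ c → |y / det2 p q| ≤ σ := by
      intro y hy; rw [abs_div, hσ]; gcongr
    have h1 := abs_le.1 (hbound _ (hq x hx))
    have h2 := abs_le.1 (hbound _ (hp x hx))
    have hx' : x = (det2 x q / det2 p q) • p + (-(det2 x p / det2 p q)) • q := by
      have h := det2_smul_eq p q x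
      rw [det2_swap x p] at h
      rw [neg_smul] at h
      rw [neg_smul, div_eq_inv_mul, div_eq_inv_mul, mul_smul, mul_smul, ← smul_neg, ← smul_add, ← h,
        inv_smul_smul₀ hpq]
    refine ⟨x + (σ • p + σ • q), (mem_parallelepiped_iff_exists v _).2
      ⟨(det2 x q / det2 p q + σ) / (2 * σ), (-(det2 x p / det2 p q) + σ) / (2 * σ),
        div_nonneg (by linarith) (by positivity), ?_, div_nonneg (by linarith) (by positivity),
        ?_, ?_⟩, by simp only [vadd_eq_add]; abel⟩
    · rw [div_le_one (by positivity)]; linarith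
    · rw [div_le_one (by positivity)]; linarith
    · simp only [hv, Matrix.cons_val_zero, Matrix.cons_val_one, smul_smul]
      rw [div_mul_cancel₀ _ (by positivity), div_mul_cancel₀ _ (by positivity)]
      conv_lhs => rw [hx']
      module

/-! ### Symmetric convex bodies and their largest inscribed symmetric parallelogram. -/

namespace IsSymmConvexBody

variable {B : Set Plane}

theorem zero_mem_interior (hB : IsSymmConvexBody B) : (0 : Plane) ∈ interior B := by
  obtain ⟨z, hz⟩ := hB.interior_nonempty
  have hneg : -B = B := by
    ext x
    exact ⟨fun h => by simpa using hB.neg_mem _ h, fun h => hB.neg_mem _ h⟩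
  have hz' : -z ∈ interior B := by
    have h : interior (-B) = -interior B := ((Homeomorph.neg Plane).preimage_interior B).symm
    rw [hneg] at h
    rw [h]; simpa
  have := hB.convex.interior hz hz' (a := 2⁻¹) (b := 2⁻¹) (by norm_num) (by norm_num) (by norm_num)
  simpa using this

theorem zero_mem (hB : IsSymmConvexBody B) : (0 : Plane) ∈ B :=
  interior_subset hB.zero_mem_interior

theorem exists_closedBall_subset (hB : IsSymmConvexBody B) :
    ∃ r > 0, Metric.closedBall (0 : Plane) r ⊆ B :=
  Metric.nhds_basis_closedBall.mem_iff.1 (mem_interior_iff_mem_nhds.1 hB.zero_mem_interior)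

/-- A symmetric convex body contains a symmetric parallelogram of maximal area. -/
theorem exists_max_det2 (hB : IsSymmConvexBody B) :
    ∃ p ∈ B, ∃ q ∈ B, 0 < det2 p q ∧ ∀ x ∈ B, ∀ y ∈ B, |det2 x y| ≤ det2 p q := by
  obtain ⟨⟨p, q⟩, ⟨hp, hq⟩, hmax⟩ := (hB.isCompact.prod hB.isCompact).exists_isMaxOn
    ⟨(0, 0), hB.zero_mem, hB.zero_mem⟩ continuous_det2.continuousOn
  have hle : ∀ x ∈ B, ∀ y ∈ B, det2 x y ≤ det2 p q := fun x hx y hy =>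
    hmax (Set.mk_mem_prod hx hy)
  refine ⟨p, hp, q, hq, ?_, fun x hx y hy => abs_le.2 ⟨?_, hle x hx y hy⟩⟩
  · obtain ⟨r, hr, hball⟩ := hB.exists_closedBall_subset
    have h1 : (!₂[r, 0] : Plane) ∈ B := hball (by
      simp [EuclideanSpace.norm_eq, Fin.sum_univ_two, Real.sqrt_sq hr.le])
    have h2 : (!₂[0, r] : Plane) ∈ B := hball (by
      simp [EuclideanSpace.norm_eq, Fin.sum_univ_two, Real.sqrt_sq hr.le])
    refine lt_of_lt_of_le ?_ (hle _ h1 _ h2)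
    simp [det2]; positivity
  · have := hle _ (hB.neg_mem x hx) y hy
    rw [det2_neg_left] at this
    linarith

theorem minParallelotopeVolume_ne_zero (hB : IsSymmConvexBody B) :
    minParallelotopeVolume B ≠ 0 := by
  have h : 0 < volume B :=
    (isOpen_interior.measure_pos volume hB.interior_nonempty).trans_le
      (measure_mono interior_subset)
  exact (h.trans_le (volume_le_minParallelotopeVolume B)).ne'

theorem minParallelotopeVolume_ne_top (hB : IsSymmConvexBody B) :
    minParallelotopeVolume B ≠ ∞ := by
  obtain ⟨p, hp, q, hq, h0, hmax⟩ := hB.exists_max_det2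
  exact ((minParallelotopeVolume_le_of_det2_le h0 h0.ne' (fun x hx => hmax x hx p hp)
    (fun x hx => hmax x hx q hq)).trans_lt ENNReal.ofReal_lt_top).ne

theorem two_le_muMassStar_four (hB : IsSymmConvexBody B) : 2 ≤ muMassStar 4 B := by
  classical
  obtain ⟨p, hp, q, hq, h0, hmax⟩ := hB.exists_max_det2
  have hmin := minParallelotopeVolume_le_of_det2_le h0 h0.ne' (fun x hx => hmax x hx p hp)
    (fun x hx => hmax x hx q hq)
  -- The parallelogram with vertices `±p`, `±q`, based at `p`.
  have hQ : IsPolytopeWithAtMost 4 (p +ᵥ parallelepiped ![q - p, -q - p]) :=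
    ⟨{p, p + (q - p), p + (-q - p), p + (q - p) + (-q - p)}, Finset.card_le_four, by
      rw [vadd_parallelepiped_eq_convexHull]; simp⟩
  have hQB : p +ᵥ parallelepiped ![q - p, -q - p] ⊆ B := by
    rw [vadd_parallelepiped_eq_convexHull]
    refine convexHull_min ?_ hB.convex
    rintro x (rfl | rfl | rfl | rfl)
    · exact hp
    · simpa
    · simpa using hB.neg_mem _ hq
    · convert hB.neg_mem _ hp using 1
      simp
      abel
  refine le_trans ?_ (le_muMassStar hQ hQB)
  rw [volume_vadd_set, volume_parallelepiped_eq]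
  have e : |det2 (![q - p, -q - p] 0) (![q - p, -q - p] 1)| = 2 * det2 p q := by
    rw [← abs_of_pos (by positivity : 0 < 2 * det2 p q)]
    congr 1
    simp [det2]; ring
  rw [e]
  have e' : 4 * det2 p q ^ 2 / |det2 p q| = 4 * det2 p q := by
    rw [abs_of_pos h0]; field_simp
  rw [e'] at hmin
  calc (2 : ℝ≥0∞) = 2 ^ 2 / ENNReal.ofReal (4 * det2 p q) * ENNReal.ofReal (2 * det2 p q) := by
        rw [ENNReal.ofReal_mul (by norm_num), ENNReal.ofReal_mul (by norm_num)]
        have h1 : ENNReal.ofReal (det2 p q) ≠ 0 := by simpa using h0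
        have h2 : ENNReal.ofReal (det2 p q) ≠ ∞ := ENNReal.ofReal_ne_top
        rw [div_eq_mul_inv, ENNReal.mul_inv (Or.inl (by simp)) (Or.inl (by simp))]
        generalize ENNReal.ofReal (det2 p q) = d at *
        calc (2 : ℝ≥0∞) = 2 * 1 * 1 := by simp
          _ = 2 * (2 ^ 2 * (2 ^ 2)⁻¹) * (d⁻¹ * d) := by
            rw [ENNReal.inv_mul_cancel h1 h2, ENNReal.mul_inv_cancel (by norm_num) (by norm_num)]
          _ = _ := by
            rw [show ENNReal.ofReal 4 = 2 ^ 2 by norm_num, show ENNReal.ofReal 2 = 2 by norm_num]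
            ring
    _ ≤ _ := by gcongr

end IsSymmConvexBody

/-! ### Self-polar sets. -/

theorem det2_map (f : Plane →ₗ[ℝ] Plane) (x y : Plane) :
    det2 (f x) (f y) = LinearMap.det f * det2 x y := by
  rw [← det_pairMap, ← det_pairMap, ← LinearMap.det_comp]
  congr 1
  ext i : 1
  simp [pairMap_apply]

theorem abs_det2_le (x y : Plane) : |det2 x y| ≤ 2 * ‖x‖ * ‖y‖ := by
  have hx : ∀ i, |x i| ≤ ‖x‖ := fun i => PiLp.norm_apply_le x i
  have hy : ∀ i, |y i| ≤ ‖y‖ := fun i => PiLp.norm_apply_le y i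
  calc |det2 x y| ≤ |x 0 * y 1| + |x 1 * y 0| := abs_sub _ _
    _ = |x 0| * |y 1| + |x 1| * |y 0| := by rw [abs_mul, abs_mul]
    _ ≤ ‖x‖ * ‖y‖ + ‖x‖ * ‖y‖ := by gcongr <;> apply_rules
    _ = _ := by ring

/-- Every linear functional of the plane is a determinant with a fixed vector. -/
theorem exists_det2_eq (f : Plane →L[ℝ] ℝ) : ∃ w : Plane, ∀ x, f x = det2 x w := by
  refine ⟨!₂[-f !₂[0, 1], f !₂[1, 0]], fun x => ?_⟩
  have : x = x 0 • !₂[1, 0] + x 1 • !₂[0, 1] := by ext i; fin_cases i <;> simp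
  conv_lhs => rw [this, map_add, map_smul, map_smul]
  simp [det2]

/-- `K` coincides with its polar with respect to the multiple `det2 / δ` of the determinant. -/
def IsDetSelfPolar (δ : ℝ) (K : Set Plane) : Prop :=
  ∀ y, y ∈ K ↔ ∀ x ∈ K, |det2 x y| ≤ δ

theorem four_div_mul_le_two {m c : ℝ≥0∞} (h : 2 * c ≤ m) : 2 ^ 2 / m * c ≤ 2 :=
  calc 2 ^ 2 / m * c = 2 * ((2 * c) / m) := by rw [div_eq_mul_inv, div_eq_mul_inv]; ring
    _ ≤ 2 * 1 := by gcongr; exact ENNReal.div_le_of_le_mul (by simpa using h)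
    _ = 2 := mul_one 2

namespace IsDetSelfPolar

variable {δ : ℝ} {K : Set Plane}

theorem neg_mem (h : IsDetSelfPolar δ K) {x : Plane} (hx : x ∈ K) : -x ∈ K :=
  (h _).2 fun y hy => by rw [det2_neg_right, abs_neg]; exact (h x).1 hx y hy

theorem convex (h : IsDetSelfPolar δ K) : Convex ℝ K := by
  intro x hx y hy a b ha hb hab
  refine (h _).2 fun z hz => ?_
  rw [det2_add_right, det2_smul_right, det2_smul_right]
  calc |a * det2 z x + b * det2 z y| ≤ |a * det2 z x| + |b * det2 z y| := abs_add_le _ _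
    _ = a * |det2 z x| + b * |det2 z y| := by
      rw [abs_mul, abs_mul, abs_of_nonneg ha, abs_of_nonneg hb]
    _ ≤ a * δ + b * δ := by
      gcongr
      · exact (h x).1 hx z hz
      · exact (h y).1 hy z hz
    _ = δ := by rw [← add_mul, hab, one_mul]

theorem isClosed (h : IsDetSelfPolar δ K) : IsClosed K := by
  have : K = ⋂ x ∈ K, {y | |det2 x y| ≤ δ} := by
    ext y; rw [h y]; simp
  rw [this]
  refine isClosed_biInter fun x _ => isClosed_le ?_ continuous_const
  exact (continuous_det2.comp (Continuous.prodMk_right x)).abs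

/-- Every parallelogram circumscribed about a self-polar set has area at least `4 * δ`. -/
theorem le_minParallelotopeVolume (h : IsDetSelfPolar δ K) (hδ : 0 < δ) :
    ENNReal.ofReal (4 * δ) ≤ minParallelotopeVolume K := by
  refine le_iInf fun P => le_iInf fun hP => le_iInf fun hKP => ?_
  obtain ⟨a, v, hv, rfl⟩ := hP
  rw [linearIndependent_iff_det2_ne_zero] at hv
  rw [volume_vadd_set, volume_parallelepiped_eq]
  apply ENNReal.ofReal_le_ofReal
  have hV : 0 < |det2 (v 0) (v 1)| := abs_pos.2 hv
  have hm : ∀ x ∈ K, ∃ s t : ℝ, 0 ≤ s ∧ s ≤ 1 ∧ 0 ≤ t ∧ t ≤ 1 ∧ x = a + (s • v 0 + t • v 1) := by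
    intro x hx
    obtain ⟨y, hy, hyx⟩ := hKP hx
    obtain ⟨s, t, h1, h2, h3, h4, rfl⟩ := (mem_parallelepiped_iff_exists v y).1 hy
    exact ⟨s, t, h1, h2, h3, h4, hyx.symm⟩
  -- The parallelogram need not be centred at the origin; averaging the coordinates of `x` and `-x`
  -- removes the translation `a` and leaves coefficients in `[-1/2, 1/2]`.
  have hwidth : ∀ x ∈ K, |det2 x (v 0)| ≤ |det2 (v 0) (v 1)| / 2 ∧
      |det2 x (v 1)| ≤ |det2 (v 0) (v 1)| / 2 := by
    intro x hx
    obtain ⟨s, t, hs0, hs1, ht0, ht1, hst⟩ := hm x hx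
    obtain ⟨s', t', hs0', hs1', ht0', ht1', hst'⟩ := hm (-x) (h.neg_mem hx)
    have hx2 : x = (2⁻¹ * (s - s')) • v 0 + (2⁻¹ * (t - t')) • v 1 := by
      have : x = (2⁻¹ : ℝ) • (x - -x) := by module
      rw [this]
      conv_lhs => rw [hst', hst]
      module
    have aux : ∀ r r' : ℝ, 0 ≤ r → r ≤ 1 → 0 ≤ r' → r' ≤ 1 → |2⁻¹ * (r - r')| ≤ 1 / 2 := by
      intro r r' _ _ _ _
      rw [abs_le]; constructor <;> linarith
    constructor
    · have e : det2 x (v 0) = -(2⁻¹ * (t - t')) * det2 (v 0) (v 1) := by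
        rw [hx2]; simp only [det2_add_left, det2_smul_left, det2_self, det2_swap (v 0) (v 1)]; ring
      rw [e, abs_mul, abs_neg]
      nlinarith [aux t t' ht0 ht1 ht0' ht1']
    · have e : det2 x (v 1) = (2⁻¹ * (s - s')) * det2 (v 0) (v 1) := by
        rw [hx2]; simp only [det2_add_left, det2_smul_left, det2_self]; ring
      rw [e, abs_mul]
      nlinarith [aux s s' hs0 hs1 hs0' hs1']
  -- With `V` the area of the parallelogram, self-polarity puts both edge vectors, scaled by `2δ/V`,
  -- into `K`. Their determinant is then at most `δ`, that is `4δ²/V ≤ δ`.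
  have hmem : ∀ w, (∀ x ∈ K, |det2 x w| ≤ |det2 (v 0) (v 1)| / 2) →
      (2 * δ / |det2 (v 0) (v 1)|) • w ∈ K := by
    intro w hw
    refine (h _).2 fun x hx => ?_
    rw [det2_smul_right, abs_mul, abs_of_pos (by positivity)]
    calc 2 * δ / |det2 (v 0) (v 1)| * |det2 x w|
        ≤ 2 * δ / |det2 (v 0) (v 1)| * (|det2 (v 0) (v 1)| / 2) := by gcongr; exact hw x hx
      _ = δ := by field_simp
  have := (h _).1 (hmem (v 1) fun x hx => (hwidth x hx).2) _ (hmem (v 0) fun x hx => (hwidth x hx).1)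
  rw [det2_smul_left, det2_smul_right, abs_mul, abs_mul, abs_of_pos (by positivity)] at this
  generalize |det2 (v 0) (v 1)| = V at *
  have e : 2 * δ / V * (2 * δ / V * V) = δ * (4 * δ) / V := by field_simp; ring
  rw [e, div_le_iff₀ hV] at this
  exact le_of_mul_le_mul_left this hδ

theorem muMassStar_four_le (h : IsDetSelfPolar δ K) (hδ : 0 < δ) : muMassStar 4 K ≤ 2 := by
  refine muMassStar_le fun Q hQ hQK => ?_
  have h1 := volume_quadrilateral_le_of_det2_le h.convex (fun x => h.neg_mem)
    (fun x hx y hy => (h y).1 hy x hx) hQ hQK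
  have h2 := h.le_minParallelotopeVolume hδ
  have e : ENNReal.ofReal (4 * δ) = 2 * ENNReal.ofReal (2 * δ) := by
    rw [show 4 * δ = 2 * (2 * δ) by ring, ENNReal.ofReal_mul (by norm_num)]; norm_num
  refine four_div_mul_le_two (h2.trans' ?_)
  rw [e]; gcongr

end IsDetSelfPolar

/-! ### Radon curves as boundaries of self-polar bodies. -/

theorem inner_quarterTurn (x y : Plane) : inner ℝ x (quarterTurn y) = -det2 x y := by
  simp [quarterTurn, det2, PiLp.inner_apply, Fin.sum_univ_two]; ring

theorem quarterTurn_bijective : Function.Bijective quarterTurn := by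
  refine Function.bijective_iff_has_inverse.2 ⟨fun x => !₂[x 1, -x 0], fun x => ?_, fun x => ?_⟩ <;>
    ext i <;> fin_cases i <;> simp [quarterTurn]

theorem abs_det2_le_iff_forall {K : Set Plane} (hK : ∀ x ∈ K, -x ∈ K) {c δ : ℝ} (hc : c ≠ 0)
    (hδ : δ = |c|⁻¹) (y : Plane) :
    (∀ x ∈ K, |det2 x y| ≤ δ) ↔ ∀ x ∈ K, -(c * det2 x y) ≤ 1 := by
  have hc' : 0 < |c| := abs_pos.2 hc
  have e : ∀ x, |det2 x y| ≤ δ ↔ |c * det2 x y| ≤ 1 := by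
    intro x
    rw [hδ, abs_mul, ← one_div, le_div_iff₀' hc']
  simp only [e]
  constructor
  · intro h x hx
    linarith [(abs_le.1 (h x hx)).1]
  · intro h x hx
    have h2 := h _ (hK x hx)
    rw [det2_neg_left] at h2
    exact abs_le.2 ⟨by linarith [h x hx], by linarith⟩

/-- Pairing with a quarter turn is minus the determinant, and `L` multiplies determinants by `det
L`; symmetry of `K` turns the one-sided polar inequality into a bound on the absolute value. -/
theorem polarSet_eq_quarterTurn_image_iff {K : Set Plane} (hK : ∀ x ∈ K, -x ∈ K)
    (L : Plane ≃ₗ[ℝ] Plane) :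
    polarSet (L '' K) = quarterTurn '' (L '' K) ↔
      IsDetSelfPolar |LinearMap.det (L : Plane →ₗ[ℝ] Plane)|⁻¹ K := by
  have hdet : LinearMap.det (L : Plane →ₗ[ℝ] Plane) ≠ 0 := (LinearEquiv.isUnit_det' L).ne_zero
  have hpol : ∀ y, quarterTurn (L y) ∈ polarSet (L '' K) ↔
      ∀ x ∈ K, |det2 x y| ≤ |LinearMap.det (L : Plane →ₗ[ℝ] Plane)|⁻¹ := by
    intro y
    rw [abs_det2_le_iff_forall hK hdet rfl]
    simp only [polarSet, Set.mem_ofPred_eq, Set.forall_mem_image, inner_quarterTurn]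
    refine forall₂_congr fun x _ => ?_
    rw [← det2_map]; rfl
  have himg : ∀ y, quarterTurn (L y) ∈ quarterTurn '' (L '' K) ↔ y ∈ K := by
    intro y
    rw [quarterTurn_bijective.1.mem_set_image, L.injective.mem_set_image]
  constructor
  · intro h y
    rw [← himg, ← h, hpol]
  · intro h
    ext z
    obtain ⟨w, rfl⟩ := quarterTurn_bijective.2 z
    obtain ⟨y, rfl⟩ := L.surjective w
    rw [himg, hpol, h y]

/-- A symmetric convex body is determined by its boundary. -/
theorem IsSymmConvexBody.subset_of_frontier_eq {B K : Set Plane} (hB : IsSymmConvexBody B)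
    (hK : IsSymmConvexBody K) (h : frontier B = frontier K) : B ⊆ K := by
  intro x hx
  by_contra hxK
  -- The segment runs from the interior of `K` to its complement, so it meets the common boundary,
  -- although its relative interior lies in the interior of `B`.
  have hne : (frontier K ∩ segment ℝ 0 x).Nonempty := by
    by_contra hemp
    rw [Set.not_nonempty_iff_eq_empty] at hemp
    obtain ⟨y, -, hyi, hyc⟩ := (convex_segment (𝕜 := ℝ) 0 x).isPreconnected (interior K) Kᶜ
      isOpen_interior hK.isCompact.isClosed.isOpen_compl (fun y hy => by
        by_contra hcon
        simp only [Set.mem_union, Set.mem_compl_iff, not_or, not_not] at hcon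
        exact hemp.subset ⟨⟨subset_closure hcon.2, hcon.1⟩, hy⟩)
      ⟨0, left_mem_segment ℝ _ _, hK.zero_mem_interior⟩ ⟨x, right_mem_segment ℝ _ _, hxK⟩
    exact hyc (interior_subset hyi)
  obtain ⟨y, hyK, hy⟩ := hne
  rw [← insert_endpoints_openSegment] at hy
  rcases hy with rfl | rfl | hy
  · exact hyK.2 hK.zero_mem_interior
  · exact hxK (hK.isCompact.isClosed.frontier_subset hyK)
  · exact (h ▸ hyK : y ∈ frontier B).2
      (hB.convex.openSegment_interior_self_subset_interior hB.zero_mem_interior hx hy)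

theorem IsSymmConvexBody.eq_of_frontier_eq {B K : Set Plane} (hB : IsSymmConvexBody B)
    (hK : IsSymmConvexBody K) (h : frontier B = frontier K) : B = K :=
  (hB.subset_of_frontier_eq hK h).antisymm (hK.subset_of_frontier_eq hB h.symm)

theorem isRadonCurve_frontier_iff {B : Set Plane} (hB : IsSymmConvexBody B) :
    IsRadonCurve (frontier B) ↔ ∃ δ > 0, IsDetSelfPolar δ B := by
  constructor
  · rintro ⟨K, hK, hBK, L, hL⟩
    obtain rfl := hB.eq_of_frontier_eq hK hBK
    refine ⟨_, ?_, (polarSet_eq_quarterTurn_image_iff hB.neg_mem L).1 hL⟩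
    exact inv_pos.2 (abs_pos.2 (LinearEquiv.isUnit_det' L).ne_zero)
  · rintro ⟨δ, hδ, h⟩
    -- The homothety with ratio `1/√δ` has determinant `1/δ`, which normalizes the polarity constant
    -- to `1`.
    have hs : (√δ)⁻¹ ≠ 0 := inv_ne_zero (Real.sqrt_ne_zero'.2 hδ)
    refine ⟨B, hB, rfl, LinearEquiv.smulOfNeZero ℝ Plane _ hs, ?_⟩
    rw [polarSet_eq_quarterTurn_image_iff hB.neg_mem]
    have : ((LinearEquiv.smulOfNeZero ℝ Plane _ hs : Plane ≃ₗ[ℝ] Plane) : Plane →ₗ[ℝ] Plane)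
        = (√δ)⁻¹ • LinearMap.id := by ext; rfl
    rw [this, LinearMap.det_smul, finrank_euclideanSpace_fin, LinearMap.det_id, mul_one, inv_pow,
      Real.sq_sqrt hδ.le, abs_of_pos (inv_pos.2 hδ), inv_inv]
    exact h

/-! ### A Radon body inside every symmetric body. -/

/-- Every symmetric convex body contains a body bounded by a Radon curve whose circumscribed
parallelograms are not smaller. -/
theorem IsSymmConvexBody.exists_isDetSelfPolar_subset {B : Set Plane} (hB : IsSymmConvexBody B) :
    ∃ K ⊆ B, IsSymmConvexBody K ∧ (∃ δ > 0, IsDetSelfPolar δ K) ∧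
      minParallelotopeVolume B ≤ minParallelotopeVolume K := by
  -- Chosen so that the bound `4 * δ` for self-polar sets equals the minimal area for `B`.
  set δ : ℝ := (minParallelotopeVolume B).toReal / 4 with hδdef
  have hδ : 0 < δ := div_pos (ENNReal.toReal_pos hB.minParallelotopeVolume_ne_zero
    hB.minParallelotopeVolume_ne_top) (by norm_num)
  have hmin : minParallelotopeVolume B = ENNReal.ofReal (4 * δ) := by
    rw [hδdef, mul_div_cancel₀ _ (by norm_num),
      ENNReal.ofReal_toReal hB.minParallelotopeVolume_ne_top]
  set T₀ : Set Plane := {y | ∀ x ∈ B, |det2 x y| ≤ δ} with hT₀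
  -- Two points of the polar `T₀` of `B` span strips containing `B`; a determinant above `δ` would
  -- give a parallelogram around `B` of area below `4δ`.
  have hT₀' : ∀ x ∈ T₀, ∀ y ∈ T₀, |det2 x y| ≤ δ := by
    intro x hx y hy
    by_cases h0 : det2 x y = 0
    · rw [h0, abs_zero]; exact hδ.le
    · have h1 := minParallelotopeVolume_le_of_det2_le hδ h0 hx hy
      have h2 : 0 < |det2 x y| := abs_pos.2 h0
      rw [hmin, ENNReal.ofReal_le_ofReal_iff (by positivity), le_div_iff₀ h2] at h1
      nlinarith
  obtain ⟨K, hTK, hK⟩ := zorn_subset_nonempty {T : Set Plane | ∀ x ∈ T, ∀ y ∈ T, |det2 x y| ≤ δ}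
    (by
      intro c hc hchain _
      refine ⟨⋃₀ c, ?_, fun s hs => Set.subset_sUnion_of_mem hs⟩
      rintro x ⟨s, hs, hx⟩ y ⟨t, ht, hy⟩
      rcases hchain.total hs ht with h | h
      · exact hc ht x (h hx) y hy
      · exact hc hs x hx y (h hy)) T₀ hT₀'
  -- By maximality, a point compatible with all of `K` can be added, since its determinant with
  -- itself vanishes.
  have hself : IsDetSelfPolar δ K := by
    intro y
    refine ⟨fun hy x hx => hK.prop x hx y hy, fun hy => ?_⟩
    refine hK.le_of_ge (y := insert y K) ?_ (Set.subset_insert y K) (Set.mem_insert y K)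
    rintro a (rfl | ha) b (rfl | hb)
    · rw [det2_self, abs_zero]; exact hδ.le
    · rw [det2_swap, abs_neg]; exact hy b hb
    · exact hy a ha
    · exact hK.prop a ha b hb
  -- The bipolar argument: a functional separating `y` from `B`, suitably scaled, is the determinant
  -- with a point of `T₀ ⊆ K`, which contradicts self-polarity at `y`.
  have hKB : K ⊆ B := by
    intro y hy
    by_contra hyB
    obtain ⟨f, u, hfB, hfy⟩ :=
      geometric_hahn_banach_closed_point hB.convex hB.isCompact.isClosed hyB
    obtain ⟨w, hw⟩ := exists_det2_eq f
    have hu : 0 < u := by simpa using hfB 0 hB.zero_mem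
    have hwT : (δ / u) • w ∈ T₀ := by
      intro x hx
      have h1 := hfB x hx
      have h2 := hfB _ (hB.neg_mem x hx)
      rw [map_neg] at h2
      rw [det2_smul_right, ← hw, abs_mul, abs_of_pos (by positivity)]
      calc δ / u * |f x| ≤ δ / u * u := by gcongr; exact abs_le.2 ⟨by linarith, h1.le⟩
        _ = δ := by field_simp
    have h3 := (abs_le.1 ((hself y).1 hy _ (hTK hwT))).1
    rw [det2_swap, det2_smul_right, ← hw] at h3
    have h4 : δ / u * f y ≤ δ / u * u := by
      rw [div_mul_cancel₀ _ hu.ne']; linarith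
    exact absurd (le_of_mul_le_mul_left h4 (by positivity)) (not_le.2 hfy)
  have hKbody : IsSymmConvexBody K := by
    refine ⟨hself.convex, hB.isCompact.of_isClosed_subset hself.isClosed hKB, ?_,
      fun x => hself.neg_mem⟩
    obtain ⟨R, hR, hBR⟩ := hB.isCompact.isBounded.exists_pos_norm_le
    refine ⟨0, mem_interior_iff_mem_nhds.2 (Filter.mem_of_superset
      (Metric.closedBall_mem_nhds 0 (show 0 < δ / (2 * R) by positivity)) ?_)⟩
    refine Set.Subset.trans (fun y hy => ?_) hTK
    intro x hx
    rw [mem_closedBall_zero_iff, le_div_iff₀ (by positivity)] at hy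
    have h1 := hBR x hx
    have h2 := abs_det2_le x y
    nlinarith [norm_nonneg y]
  exact ⟨K, hKB, hKbody, ⟨δ, hδ, hself⟩, hmin ▸ hself.le_minParallelotopeVolume hδ⟩

/-! ### Existence of a minimizer by compactness. -/

/-- Here `x = y + (t - 1)z` with `z` in the inscribed disc, which is `t` times a convex combination
of `y` and `z`. This converts Hausdorff closeness into inclusion up to a dilation. -/
theorem mem_smul_of_norm_sub_le {K : Set Plane} (hK : Convex ℝ K) {r t : ℝ} (ht : 1 < t)
    (hr : Metric.closedBall 0 r ⊆ K) {x y : Plane} (hy : y ∈ K) (hxy : ‖x - y‖ ≤ (t - 1) * r) :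
    x ∈ t • K := by
  have ht0 : 0 < t := by linarith
  have ht1 : 0 < t - 1 := by linarith
  have hz : (t - 1)⁻¹ • (x - y) ∈ K := hr (by
    rw [mem_closedBall_zero_iff, norm_smul, Real.norm_of_nonneg (inv_nonneg.2 ht1.le),
      inv_mul_le_iff₀ ht1]
    exact hxy)
  refine ⟨t⁻¹ • y + ((t - 1) / t) • ((t - 1)⁻¹ • (x - y)),
    hK hy hz (by positivity) (by positivity) (by field_simp; ring), ?_⟩
  change t • (t⁻¹ • y + ((t - 1) / t) • ((t - 1)⁻¹ • (x - y))) = x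
  have e : (t - 1) / t * (t - 1)⁻¹ = t⁻¹ := by field_simp
  rw [smul_smul, e, ← smul_add, smul_inv_smul₀ ht0.ne']
  abel

/-- The symmetric convex bodies that lie between the discs of radii `1 / 2` and `2`. -/
def pinchedBodies : Set (TopologicalSpace.NonemptyCompacts Plane) :=
  {K | IsSymmConvexBody (K : Set Plane) ∧ Metric.closedBall 0 (1 / 2) ⊆ (K : Set Plane) ∧
    (K : Set Plane) ⊆ Metric.closedBall 0 2}

theorem mem_iff_infDist_eq_zero (K : TopologicalSpace.NonemptyCompacts Plane) (x : Plane) :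
    x ∈ (K : Set Plane) ↔ Metric.infDist x K = 0 :=
  K.isCompact.isClosed.mem_iff_infDist_zero K.nonempty

theorem infDist_neg_le {K : Set Plane} (hne : K.Nonempty) (hK : ∀ x ∈ K, -x ∈ K) (x : Plane) :
    Metric.infDist (-x) K ≤ Metric.infDist x K := by
  refine (Metric.le_infDist hne).2 fun y hy => ?_
  refine (Metric.infDist_le_dist_of_mem (hK y hy)).trans ?_
  rw [dist_neg_neg]

theorem infDist_combo_le {K : Set Plane} (hne : K.Nonempty) (hK : IsCompact K) (hc : Convex ℝ K)
    (x y : Plane) {a b : ℝ} (ha : 0 ≤ a) (hb : 0 ≤ b) (hab : a + b = 1) :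
    Metric.infDist (a • x + b • y) K ≤ a * Metric.infDist x K + b * Metric.infDist y K := by
  obtain ⟨x', hx', hx⟩ := hK.exists_infDist_eq_dist hne x
  obtain ⟨y', hy', hy⟩ := hK.exists_infDist_eq_dist hne y
  rw [hx, hy]
  refine (Metric.infDist_le_dist_of_mem (hc hx' hy' ha hb hab)).trans ?_
  rw [dist_eq_norm, dist_eq_norm, dist_eq_norm]
  calc ‖a • x + b • y - (a • x' + b • y')‖ = ‖a • (x - x') + b • (y - y')‖ := by
        congr 1; module
    _ ≤ ‖a • (x - x')‖ + ‖b • (y - y')‖ := norm_add_le _ _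
    _ = _ := by rw [norm_smul, norm_smul, Real.norm_of_nonneg ha, Real.norm_of_nonneg hb]

/-- Each condition becomes an inequality between distances to `K`, which depend continuously on `K`
in the Hausdorff metric, so closedness is immediate; convexity of `K` becomes convexity of its
distance function. -/
theorem pinchedBodies_eq : pinchedBodies =
    {K : TopologicalSpace.NonemptyCompacts Plane | (K : Set Plane) ⊆ Metric.closedBall 0 2} ∩
    ({K : TopologicalSpace.NonemptyCompacts Plane |
      ∀ x ∈ Metric.closedBall (0 : Plane) (1 / 2), Metric.infDist x (K : Set Plane) ≤ 0} ∩
    ({K : TopologicalSpace.NonemptyCompacts Plane |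
      ∀ x, Metric.infDist (-x) K ≤ Metric.infDist x (K : Set Plane)} ∩
    {K : TopologicalSpace.NonemptyCompacts Plane |
      ∀ x y (a b : ℝ), 0 ≤ a → 0 ≤ b → a + b = 1 →
      Metric.infDist (a • x + b • y) K ≤
        a * Metric.infDist x (K : Set Plane) + b * Metric.infDist y (K : Set Plane)})) := by
  ext K
  constructor
  · rintro ⟨h1, h2, h3⟩
    exact ⟨h3, fun x hx => ((mem_iff_infDist_eq_zero K x).1 (h2 hx)).le,
      infDist_neg_le K.nonempty h1.neg_mem,
      fun x y a b => infDist_combo_le K.nonempty K.isCompact h1.convex x y⟩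
  · rintro ⟨h3, h2, h1, h0⟩
    have h2' : Metric.closedBall 0 (1 / 2) ⊆ (K : Set Plane) := fun x hx =>
      (mem_iff_infDist_eq_zero K x).2 ((h2 x hx).antisymm Metric.infDist_nonneg)
    refine ⟨⟨?_, K.isCompact, ?_, ?_⟩, h2', h3⟩
    · intro x hx y hy a b ha hb hab
      have := h0 x y a b ha hb hab
      rw [(mem_iff_infDist_eq_zero K x).1 hx, (mem_iff_infDist_eq_zero K y).1 hy] at this
      exact (mem_iff_infDist_eq_zero K _).2 ((by simpa using this : _ ≤ (0 : ℝ)).antisymm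
        Metric.infDist_nonneg)
    · exact ⟨0, mem_interior_iff_mem_nhds.2 (Filter.mem_of_superset
        (Metric.closedBall_mem_nhds 0 (by norm_num)) h2')⟩
    · intro x hx
      have := h1 x
      rw [(mem_iff_infDist_eq_zero K x).1 hx] at this
      exact (mem_iff_infDist_eq_zero K _).2 (this.antisymm Metric.infDist_nonneg)

theorem isCompact_pinchedBodies : IsCompact pinchedBodies := by
  have hcont : ∀ x : Plane, Continuous fun K : TopologicalSpace.NonemptyCompacts Plane =>
      Metric.infDist x K := fun x => (Metric.lipschitz_infDist_set x).continuous
  rw [pinchedBodies_eq]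
  refine IsCompact.inter_right
    (TopologicalSpace.NonemptyCompacts.isCompact_subsets_of_isCompact (isCompact_closedBall 0 2)) ?_
  refine IsClosed.inter ?_ (IsClosed.inter ?_ ?_)
  · simp only [Set.ofPred_forall]
    exact isClosed_biInter fun x _ => isClosed_le (hcont x) continuous_const
  · simp only [Set.ofPred_forall]
    exact isClosed_iInter fun x => isClosed_le (hcont _) (hcont x)
  · simp only [Set.ofPred_forall]
    exact isClosed_iInter fun x => isClosed_iInter fun y => isClosed_iInter fun a =>
      isClosed_iInter fun b => isClosed_iInter fun _ => isClosed_iInter fun _ =>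
      isClosed_iInter fun _ => isClosed_le (hcont _)
        ((continuous_const.mul (hcont x)).add (continuous_const.mul (hcont y)))

theorem subset_smul_of_dist_lt {K C : TopologicalSpace.NonemptyCompacts Plane}
    (hC : C ∈ pinchedBodies) {t : ℝ} (ht : 1 < t) (h : dist K C < (t - 1) * (1 / 2)) :
    (K : Set Plane) ⊆ t • (C : Set Plane) := by
  intro x hx
  rw [Metric.NonemptyCompacts.dist_eq] at h
  obtain ⟨y, hy, hxy⟩ := Metric.exists_dist_lt_of_hausdorffDist_lt hx h
    (Metric.hausdorffEDist_ne_top_of_nonempty_of_bounded K.nonempty C.nonempty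
      K.isCompact.isBounded C.isCompact.isBounded)
  exact mem_smul_of_norm_sub_le hC.1.convex ht hC.2.1 hy (by rw [← dist_eq_norm]; exact hxy.le)

theorem lowerSemicontinuousOn_muMassStar (n : ℕ) :
    LowerSemicontinuousOn (fun K : TopologicalSpace.NonemptyCompacts Plane =>
      muMassStar n (K : Set Plane)) pinchedBodies := by
  intro K hK c hc
  have hcont : Filter.Tendsto (fun t : ℝ => ENNReal.ofReal t ^ 4 * c) (nhdsWithin 1 (Set.Ioi 1))
      (nhds c) := by
    have h1 : Filter.Tendsto (fun t : ℝ => ENNReal.ofReal t ^ 4) (nhdsWithin 1 (Set.Ioi 1))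
        (nhds 1) := by
      have : Continuous fun t : ℝ => ENNReal.ofReal t ^ 4 :=
        (ENNReal.continuous_pow 4).comp ENNReal.continuous_ofReal
      have h := this.tendsto 1
      simp only [ENNReal.ofReal_one, one_pow] at h
      exact h.mono_left nhdsWithin_le_nhds
    simpa using ENNReal.Tendsto.mul_const (b := c) h1 (Or.inl one_ne_zero)
  -- A dilation ratio `t > 1` so close to `1` that `t⁴c` is still below the value at `K`; nearby
  -- bodies then have value above `c`.
  obtain ⟨t, htc, ht⟩ := ((hcont.eventually_lt_const hc).and self_mem_nhdsWithin).exists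
  have ht : 1 < t := ht
  have hball : Metric.ball K ((t - 1) * (1 / 2)) ∈ nhdsWithin K pinchedBodies :=
    mem_nhdsWithin_of_mem_nhds (Metric.ball_mem_nhds K (by nlinarith))
  filter_upwards [hball, self_mem_nhdsWithin] with C hCK hC
  have hCK : dist C K < (t - 1) * (1 / 2) := hCK
  by_contra hcon
  have h := muMassStar_le_of_subset_smul (n := n) (by linarith : 0 < t)
    (subset_smul_of_dist_lt hC ht (dist_comm C K ▸ hCK)) (subset_smul_of_dist_lt hK ht hCK)
  exact absurd (h.trans (mul_le_mul_right (not_lt.1 hcon) _)) (not_le.2 htc)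

theorem IsSymmConvexBody.smul_mem {B : Set Plane} (hB : IsSymmConvexBody B) {p : Plane}
    (hp : p ∈ B) {c : ℝ} (hc : |c| ≤ 1) : c • p ∈ B := by
  obtain ⟨h1, h2⟩ := abs_le.1 hc
  have := hB.convex hp (hB.neg_mem p hp) (a := (1 + c) / 2) (b := (1 - c) / 2) (by linarith)
    (by linarith) (by ring)
  convert this using 1
  module

/-- Every symmetric convex body has a linear image between the discs of radii `1 / 2` and `2`. -/
theorem IsSymmConvexBody.exists_pinched {B : Set Plane} (hB : IsSymmConvexBody B) (n : ℕ) :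
    ∃ K ∈ pinchedBodies, muMassStar n (K : Set Plane) = muMassStar n B := by
  obtain ⟨p, hp, q, hq, h0, hmax⟩ := hB.exists_max_det2
  -- In the coordinates where `p`, `q` are the standard basis, convexity gives `|x 0| + |x 1| ≤ 1`
  -- as an inner bound for the body, and maximality of the determinant gives `|x 0|, |x 1| ≤ 1` as
  -- an outer bound.
  set L : Plane ≃ₗ[ℝ] Plane := (pairMap p q).equivOfDetNeZero (by rw [det_pairMap]; exact h0.ne')
    with hL
  have hLx : ∀ x, L x = x 0 • p + x 1 • q := fun x => rfl
  have hmem : ∀ x, x ∈ L.symm '' B ↔ L x ∈ B := by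
    intro x
    constructor
    · rintro ⟨y, hy, rfl⟩; simpa
    · intro h; exact ⟨L x, h, by simp⟩
  have hin : Metric.closedBall 0 (1 / 2) ⊆ L.symm '' B := by
    intro x hx
    rw [mem_closedBall_zero_iff] at hx
    have hi : ∀ i, |2 * x i| ≤ 1 := by
      intro i
      have h1 : |x i| ≤ ‖x‖ := PiLp.norm_apply_le x i
      rw [abs_mul, abs_two]; linarith
    rw [hmem, hLx]
    have := hB.convex (hB.smul_mem hp (hi 0)) (hB.smul_mem hq (hi 1)) (a := 1 / 2) (b := 1 / 2)
      (by norm_num) (by norm_num) (by norm_num)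
    convert this using 1
    module
  have hout : L.symm '' B ⊆ Metric.closedBall 0 2 := by
    intro x hx
    rw [hmem, hLx] at hx
    have h1 := hmax _ hx _ hq
    have h2 := hmax _ hp _ hx
    simp only [det2_add_left, det2_add_right, det2_smul_left, det2_smul_right, det2_self, mul_zero,
      add_zero, zero_add, abs_mul, abs_of_pos h0] at h1 h2
    have h1' : |x 0| ≤ 1 := le_of_mul_le_mul_right (by linarith) h0
    have h2' : |x 1| ≤ 1 := le_of_mul_le_mul_right (by linarith) h0
    rw [mem_closedBall_zero_iff, EuclideanSpace.norm_eq, Fin.sum_univ_two]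
    simp only [Real.norm_eq_abs, sq_abs]
    rw [Real.sqrt_le_left (by norm_num)]
    nlinarith [(sq_le_one_iff_abs_le_one (x 0)).2 h1', (sq_le_one_iff_abs_le_one (x 1)).2 h2']
  have hcomp : IsCompact (L.symm '' B) :=
    hB.isCompact.image (L.symm : Plane →ₗ[ℝ] Plane).continuous_of_finiteDimensional
  refine ⟨⟨⟨L.symm '' B, hcomp⟩, ⟨0, hin (by simp)⟩⟩, ⟨⟨?_, hcomp, ?_, ?_⟩, hin, hout⟩,
    muMassStar_image n L.symm B⟩
  · exact hB.convex.linear_image (L.symm : Plane →ₗ[ℝ] Plane)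
  · exact ⟨0, mem_interior_iff_mem_nhds.2 (Filter.mem_of_superset
      (Metric.closedBall_mem_nhds 0 (by norm_num)) hin)⟩
  · intro x hx
    have hx : x ∈ L.symm '' B := hx
    have : -x ∈ L.symm '' B := by
      rw [hmem] at hx ⊢
      rw [map_neg]; exact hB.neg_mem _ hx
    exact this

theorem exists_isSymmConvexBody_isParallelotope :
    ∃ B : Set Plane, IsSymmConvexBody B ∧ IsParallelotope B := by
  set v : Fin 2 → Plane := ![!₂[2, 0], !₂[0, 2]] with hv
  have hmem : ∀ x : Plane, x ∈ (!₂[-1, -1] : Plane) +ᵥ parallelepiped v ↔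
      |x 0| ≤ 1 ∧ |x 1| ≤ 1 := by
    intro x
    simp only [Set.mem_vadd_set, mem_parallelepiped_iff_exists, abs_le]
    constructor
    · rintro ⟨_, ⟨s, t, h1, h2, h3, h4, rfl⟩, rfl⟩
      simp [hv]
      refine ⟨⟨by linarith, by linarith⟩, by linarith, by linarith⟩
    · rintro ⟨⟨h1, h2⟩, h3, h4⟩
      refine ⟨x + !₂[1, 1], ⟨(x 0 + 1) / 2, (x 1 + 1) / 2, by linarith, by linarith, by linarith,
        by linarith, ?_⟩, ?_⟩ <;> ext i <;> fin_cases i <;> simp [hv]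
  refine ⟨(!₂[-1, -1] : Plane) +ᵥ parallelepiped v, ⟨(convex_parallelepiped v).vadd _, ?_, ?_, ?_⟩,
    _, v, ?_, rfl⟩
  · rw [vadd_parallelepiped_eq_convexHull]
    exact Set.Finite.isCompact_convexHull ℝ (Set.toFinite _)
  · refine ⟨0, mem_interior_iff_mem_nhds.2 (Filter.mem_of_superset
      (Metric.closedBall_mem_nhds 0 one_pos) fun x hx => (hmem x).2 ?_)⟩
    rw [mem_closedBall_zero_iff] at hx
    exact ⟨(PiLp.norm_apply_le x 0).trans hx, (PiLp.norm_apply_le x 1).trans hx⟩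
  · intro x hx
    rw [hmem] at hx ⊢
    simpa using hx
  · rw [linearIndependent_iff_det2_ne_zero]
    simp [hv, det2]

theorem exists_muMassStar_minimal (n : ℕ) :
    ∃ B : Set Plane, IsSymmConvexBody B ∧ muMassStar n B = infMassStar n 2 := by
  obtain ⟨S, hS, -⟩ := exists_isSymmConvexBody_isParallelotope
  obtain ⟨K₀, hK₀, -⟩ := hS.exists_pinched n
  obtain ⟨K, hK, hmin⟩ := (lowerSemicontinuousOn_muMassStar n).exists_isMinOn ⟨K₀, hK₀⟩
    isCompact_pinchedBodies
  refine ⟨K, hK.1, le_antisymm (le_iInf fun B => le_iInf fun hB => ?_)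
    (iInf_le_of_le (K : Set Plane) (iInf_le _ hK.1))⟩
  obtain ⟨C, hC, hCB⟩ := hB.exists_pinched n
  rw [← hCB]
  exact hmin hC

/-! ### Extremality of parallelograms, and Radon minimizers. -/

theorem minParallelotopeVolume_eq_volume {P : Set Plane} (hP : IsParallelotope P) :
    minParallelotopeVolume P = volume P :=
  (minParallelotopeVolume_le hP subset_rfl).antisymm (volume_le_minParallelotopeVolume P)

theorem muMassStar_le_four (n : ℕ) (B : Set Plane) : muMassStar n B ≤ 4 := by
  refine muMassStar_le fun Q _ hQB => ?_
  have h : volume Q ≤ minParallelotopeVolume B :=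
    (measure_mono hQB).trans (volume_le_minParallelotopeVolume B)
  calc 2 ^ 2 / minParallelotopeVolume B * volume Q
      = 2 ^ 2 * (volume Q / minParallelotopeVolume B) := by
        rw [div_eq_mul_inv, div_eq_mul_inv]; ring
    _ ≤ 2 ^ 2 * 1 := by gcongr; exact ENNReal.div_le_of_le_mul (by simpa using h)
    _ = 4 := by norm_num

theorem muMassStar_three_le_two (B : Set Plane) : muMassStar 3 B ≤ 2 := by
  refine muMassStar_le fun Q hQ hQB => four_div_mul_le_two ?_
  refine le_iInf fun P => le_iInf fun hP => le_iInf fun hB => ?_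
  obtain ⟨a, v, hv, rfl⟩ := hP
  have h := volume_triangle_le_of_subset_parallelogram hQ a v (hQB.trans hB)
  rw [volume_vadd_set, volume_parallelepiped_eq]
  calc 2 * volume Q ≤ 2 * ENNReal.ofReal (|det2 (v 0) (v 1)| / 2) := by gcongr
    _ = ENNReal.ofReal (2 * (|det2 (v 0) (v 1)| / 2)) := by
      rw [ENNReal.ofReal_mul (by norm_num)]; norm_num
    _ = _ := by congr 1; ring

theorem two_le_muMassStar_three {P : Set Plane} (hP : IsParallelotope P) :
    2 ≤ muMassStar 3 P := by
  classical
  obtain ⟨a, v, hv, rfl⟩ := id hP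
  rw [linearIndependent_iff_det2_ne_zero] at hv
  have hQ : IsPolytopeWithAtMost 3 (convexHull ℝ {a, a + v 0, a + v 1}) :=
    ⟨{a, a + v 0, a + v 1}, Finset.card_le_three, by simp⟩
  have hQP : convexHull ℝ {a, a + v 0, a + v 1} ⊆ a +ᵥ parallelepiped v := by
    rw [vadd_parallelepiped_eq_convexHull]
    apply convexHull_mono
    intro x hx
    simp only [Set.mem_insert_iff, Set.mem_singleton_iff] at hx ⊢
    tauto
  refine le_trans (le_of_eq ?_) (le_muMassStar hQ hQP)
  rw [minParallelotopeVolume_eq_volume hP, volume_vadd_set, volume_parallelepiped_eq,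
    volume_triangle, add_sub_cancel_left, add_sub_cancel_left,
    ENNReal.ofReal_div_of_pos two_pos]
  have h1 : ENNReal.ofReal |det2 (v 0) (v 1)| ≠ 0 := by simpa using hv
  have h2 : ENNReal.ofReal |det2 (v 0) (v 1)| ≠ ∞ := ENNReal.ofReal_ne_top
  generalize ENNReal.ofReal |det2 (v 0) (v 1)| = d at *
  calc (2 : ℝ≥0∞) = 2 * (2 * 2⁻¹) * (d⁻¹ * d) := by
        rw [ENNReal.inv_mul_cancel h1 h2, ENNReal.mul_inv_cancel (by norm_num) (by norm_num)]
        simp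
    _ = _ := by
      rw [show ENNReal.ofReal 2 = 2 by norm_num, div_eq_mul_inv, div_eq_mul_inv]; ring

theorem four_le_muMassStar {n : ℕ} (hn : 4 ≤ n) {P : Set Plane} (hP : IsParallelotope P) :
    4 ≤ muMassStar n P := by
  classical
  obtain ⟨a, v, hv, rfl⟩ := id hP
  rw [linearIndependent_iff_det2_ne_zero] at hv
  have hQ : IsPolytopeWithAtMost n (a +ᵥ parallelepiped v) :=
    ⟨{a, a + v 0, a + v 1, a + v 0 + v 1}, Finset.card_le_four.trans hn, by
      rw [vadd_parallelepiped_eq_convexHull]; simp⟩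
  refine le_trans (le_of_eq ?_) (le_muMassStar hQ subset_rfl)
  rw [minParallelotopeVolume_eq_volume hP, volume_vadd_set, volume_parallelepiped_eq,
    ENNReal.div_mul_cancel (by simpa using hv) ENNReal.ofReal_ne_top]
  norm_num

theorem supMassStar_eq_of_isParallelotope {n : ℕ} {c : ℝ≥0∞}
    (hle : ∀ B : Set Plane, muMassStar n B ≤ c)
    (hge : ∀ B : Set Plane, IsParallelotope B → c ≤ muMassStar n B) :
    supMassStar n 2 = c ∧ ∀ B : Set Plane, IsSymmConvexBody B → IsParallelotope B →
      muMassStar n B = supMassStar n 2 := by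
  obtain ⟨S, hS, hSP⟩ := exists_isSymmConvexBody_isParallelotope
  have h : supMassStar n 2 = c := le_antisymm (iSup_le fun B => iSup_le fun _ => hle B)
    ((hge S hSP).trans (le_iSup_of_le (f := fun B => ⨆ _ : IsSymmConvexBody B, muMassStar n B) S
      (le_iSup_of_le hS le_rfl)))
  exact ⟨h, fun B _ hB => h ▸ (hle B).antisymm (hge B hB)⟩

theorem muMassStar_four_eq_two {B : Set Plane} (hB : IsSymmConvexBody B)
    (hR : IsRadonCurve (frontier B)) : muMassStar 4 B = 2 := by
  obtain ⟨δ, hδ, h⟩ := (isRadonCurve_frontier_iff hB).1 hR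
  exact (h.muMassStar_four_le hδ).antisymm hB.two_le_muMassStar_four

theorem exists_radon_muMassStar_minimal (n : ℕ) : ∃ B : Set Plane, IsSymmConvexBody B ∧
    muMassStar n B = infMassStar n 2 ∧ IsRadonCurve (frontier B) := by
  obtain ⟨B, hB, hBmin⟩ := exists_muMassStar_minimal n
  obtain ⟨K, hKB, hK, hself, hvol⟩ := hB.exists_isDetSelfPolar_subset
  refine ⟨K, hK, le_antisymm ?_ (iInf_le_of_le K (iInf_le _ hK)),
    (isRadonCurve_frontier_iff hK).2 hself⟩
  rw [← hBmin]
  -- A polygon in `K` also lies in `B`, where its normalized area is at least as large because `m(B)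
  -- ≤ m(K)`.
  refine muMassStar_le fun Q hQ hQK => le_trans ?_ (le_muMassStar hQ (hQK.trans hKB))
  gcongr

end

theorem theorem5p1 :
    (supMassStar 3 2 = 2 ∧
      ∀ B : Set (EuclideanSpace ℝ (Fin 2)), IsSymmConvexBody B → IsParallelotope B →
        muMassStar 3 B = supMassStar 3 2) ∧
    (∀ n : ℕ, 4 ≤ n →
      supMassStar n 2 = 4 ∧
      ∀ B : Set (EuclideanSpace ℝ (Fin 2)), IsSymmConvexBody B → IsParallelotope B →
        muMassStar n B = supMassStar n 2) ∧
    (infMassStar 4 2 = 2 ∧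
      ∀ B : Set (EuclideanSpace ℝ (Fin 2)), IsSymmConvexBody B → IsRadonCurve (frontier B) →
        muMassStar 4 B = infMassStar 4 2) ∧
    (∀ n : ℕ, 3 ≤ n →
      ∃ B : Set (EuclideanSpace ℝ (Fin 2)), IsSymmConvexBody B ∧
        muMassStar n B = infMassStar n 2 ∧ IsRadonCurve (frontier B)) := by
  have hinf : infMassStar 4 2 = 2 := by
    obtain ⟨B, hB, hBmin, hR⟩ := exists_radon_muMassStar_minimal 4
    rw [← hBmin, muMassStar_four_eq_two hB hR]
  exact ⟨supMassStar_eq_of_isParallelotope muMassStar_three_le_two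
      fun B => two_le_muMassStar_three,
    fun n hn => supMassStar_eq_of_isParallelotope (muMassStar_le_four n)
      fun B => four_le_muMassStar hn,
    ⟨hinf, fun B hB hR => by rw [hinf, muMassStar_four_eq_two hB hR]⟩,
    fun n _ => exists_radon_muMassStar_minimal n⟩
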